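/- Let $k,\ell,a$ be integers with $1<k<\ell$ and $0\le a\le k-2$. Let $V$ be a complex vector space of dimension $2\ell$ with a bilinear form $\omega$ and a basis $e_1,\dots,e_{2\ell}$ such that $\omega(e_{\ell-i},e_{\ell+i+1})=-\omega(e_{\ell+i+1},e_{\ell-i})=1$ for $0\le i\le \ell-1$ and all other $\omega(e_i,e_j)$ vanish; put $F_j=\langle e_1,\dots,e_j\rangle$. Let $X=\mathrm{Gr}_\omega(k,2\ell)$ be the symplectic Grassmannian of $k$-dimensional isotropic subspaces of $V$, and let $$Z=\mathrm{Gr}_\omega(k,2\ell;F_a,F_{2\ell-a-1})=\{E\in X: F_a\subset E\subset F_{2\ell-a-1}\},$$ an odd symplectic Grassmannian. For a point $x$ let $\mathcal A\subset\mathbb P(T_xX)$ and $\mathcal B\subset\mathbb P(T_xZ)\subset\mathbb P(T_xX)$ be the varieties of minimal rational tangents of $X$ and of $Z$ at $x$, that is, the closures of the sets of tangent directions at $x$ of the rational curves through $x$ in $X$, respectively in $Z$, which have minimal positive degree with respect to the Plücker embedding (these are lines). Let $\widetilde{\mathcal A},\widetilde{\mathcal B}\subset T_xX\setminus\{0\}$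 be their affine cones. Then, for a general point $x$ of $Z$ (i.e. for all $x$ in some Zariski dense, Zariski open subset of $Z$), the pair $(\mathcal A,\mathcal B)$ is nondegenerate: $\mathcal B\subset\mathcal A$, and for every $\beta\in\widetilde{\mathcal B}$, $$\{\zeta\in T_\beta\widetilde{\mathcal A}:\ \sigma_\beta(\zeta,\xi)=0\ \text{ for all } \xi\in T_\beta\widetilde{\mathcal B}\}=\mathbb C\beta,$$ where $\sigma_\beta\colon T_\beta\widetilde{\mathcal A}\times T_\beta\widetilde{\mathcal A}\to T_xX/T_\beta\widetilde{\mathcal A}$ is the second fundamental form of $\widetilde{\mathcal A}\subset T_xX$ at $\beta$: $\sigma_\beta(\alpha'(0),\rho(0))=\rho'(0)\bmod T_\beta\widetilde{\mathcal A}$ for every holomorphic arc $\alpha$ in $\widetilde{\mathcal A}$ with $\alpha(0)=\beta$ and every holomorphic vector field $\rho$ along $\alpha$ with $\rho(t)\in T_{\alpha(t)}\widetilde{\mathcal A}$. -/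

import Mathlib

open scoped LinearAlgebra.Projectivization

noncomputable section

namespace SymplecticVMRT

/-! ### Holomorphic arcs and polynomial functions in a finite-dimensional complex vector space -/

section VectorSpace

variable {W : Type*} [AddCommGroup W] [Module ℂ W]

/-- The germ at `0` of `γ : ℂ → W` is holomorphic and `γ'(0) = v` (tested in linear coordinates;
`W` is meant to be finite-dimensional). -/
def HasHolDeriv (γ : ℂ → W) (v : W) : Prop :=
  ∀ φ : Module.Dual ℂ W,
    AnalyticAt ℂ (fun t => φ (γ t)) 0 ∧ deriv (fun t => φ (γ t)) 0 = φ v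

variable (W) in
/-- The algebra of polynomial functions on `W`, generated by the linear functionals. -/
def polyFun : Subalgebra ℂ (W → ℂ) :=
  Algebra.adjoin ℂ (Set.range fun φ : Module.Dual ℂ W => (φ : W → ℂ))

/-- The Zariski closure of a subset of `W`. -/
def zariskiClosure (S : Set W) : Set W :=
  {x | ∀ p ∈ polyFun W, (∀ y ∈ S, p y = 0) → p x = 0}

/-- The affine cone (without the origin) over a subset of `ℙ(W)`. -/
def affineCone (A : Set (ℙ ℂ W)) : Set W :=
  {w | ∃ hw : w ≠ 0, Projectivization.mk ℂ w hw ∈ A}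

/-- `α` is the germ of a holomorphic arc in `S` with `α(0) = β` and `α'(0) = ξ`. -/
def IsArc (S : Set W) (β : W) (α : ℂ → W) (ξ : W) : Prop :=
  α 0 = β ∧ (∀ᶠ t in nhds (0 : ℂ), α t ∈ S) ∧ HasHolDeriv α ξ

/-- The tangent space `T_β S`: the span of the velocities at `β` of holomorphic arcs in `S`
(at a smooth point these velocities already form a linear subspace). -/
def tangentSpace (S : Set W) (β : W) : Submodule ℂ W :=
  Submodule.span ℂ {ξ | ∃ α, IsArc S β α ξ}

/-- There are an arc `α` in `S` with `α(0) = β`, `α'(0) = ξ` and a holomorphic vector field `ρ`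
along it, `ρ(t) ∈ T_{α(t)} S`, with `ρ(0) = ζ` and `ρ'(0) = v`. -/
def IsMovingVector (S : Set W) (β ξ ζ v : W) : Prop :=
  ∃ α ρ : ℂ → W, IsArc S β α ξ ∧
    ρ 0 = ζ ∧ (∀ᶠ t in nhds (0 : ℂ), ρ t ∈ tangentSpace S (α t)) ∧ HasHolDeriv ρ v

/-- `σ` is the second fundamental form of `S ⊆ W` at `β`, i.e. the differential of the Gauss map:
`σ(α'(0), ρ(0)) = ρ'(0) mod T_β S` for all arcs `α` in `S` through `β` and all holomorphic vector
fields `ρ` along `α` tangent to `S`. The equivalence says that every pair of tangent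
vectors occurs and that the value does not depend on the choices, so `σ` is unique. -/
def IsSecondFundamentalForm (S : Set W) (β : W)
    (σ : tangentSpace S β →ₗ[ℂ] tangentSpace S β →ₗ[ℂ] (W ⧸ tangentSpace S β)) : Prop :=
  ∀ (ξ ζ : tangentSpace S β) (y : W ⧸ tangentSpace S β),
    σ ξ ζ = y ↔ ∃ v : W, IsMovingVector S β ξ ζ v ∧ (tangentSpace S β).mkQ v = y

/-- `Ker σ(·, F) = {ζ ∈ T : σ(ζ, ξ) = 0 for all ξ ∈ F}`, for a subspace `F` of `T`. -/
def kerAgainst {T : Submodule ℂ W} (σ : T →ₗ[ℂ] T →ₗ[ℂ] (W ⧸ T)) (F : Submodule ℂ W) : Set W :=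
  {z | ∃ ζ : T, (ζ : W) = z ∧ ∀ ξ : T, (ξ : W) ∈ F → σ ζ ξ = 0}

/-- A pair `ℬ ⊆ 𝒜 ⊆ ℙ(W)` is nondegenerate if for every `β` in the affine cone of `ℬ` the second
fundamental form `σ` of the affine cone of `𝒜` at `β` satisfies
`Ker σ(·, T_β ℬ̃) = ℂ β`. -/
def IsNondegeneratePair (A B : Set (ℙ ℂ W)) : Prop :=
  B ⊆ A ∧ ∀ β ∈ affineCone B,
    ∃ σ : tangentSpace (affineCone A) β →ₗ[ℂ] tangentSpace (affineCone A) β →ₗ[ℂ]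
        (W ⧸ tangentSpace (affineCone A) β),
      IsSecondFundamentalForm (affineCone A) β σ ∧
      kerAgainst σ (tangentSpace (affineCone B) β) = (Submodule.span ℂ {β} : Set W)

end VectorSpace

/-! ### Curves in Grassmannians and varieties of minimal rational tangents

A subvariety of `Gr(k, V)` is given by the set of its points, which are `k`-dimensional subspaces
of `V`. The tangent space of `Gr(k, V)` at `E` is `Hom(E, V/E)`. -/

section Grassmannian

variable {V : Type*} [AddCommGroup V] [Module ℂ V]

/-- The arc `t ↦ γ t` of `k`-dimensional subspaces is holomorphic at `t = 0`, `γ 0 = E`, and its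
velocity at `0` is `h ∈ Hom(E, V/E) = T_E Gr(k, V)`: there is a holomorphic frame
`w₁(t), …, w_k(t)` of `γ t` near `0` with `h (w_i(0)) = w_i'(0) mod E`. -/
def HasGrVelocity (k : ℕ) (γ : ℂ → Submodule ℂ V) (E : Submodule ℂ V)
    (h : E →ₗ[ℂ] V ⧸ E) : Prop :=
  γ 0 = E ∧ ∃ (w : ℂ → Fin k → V) (w' : Fin k → V),
    (∀ᶠ t in nhds (0 : ℂ),
      LinearIndependent ℂ (w t) ∧ Submodule.span ℂ (Set.range (w t)) = γ t) ∧
    (∀ i, HasHolDeriv (fun t => w t i) (w' i)) ∧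
    ∀ (i : Fin k) (hi : w 0 i ∈ E), h ⟨w 0 i, hi⟩ = E.mkQ (w' i)

/-- The tangent space `T_E X ⊆ Hom(E, V/E)` of a submanifold `X ⊆ Gr(k, V)`, spanned by the
velocities of holomorphic arcs in `X` through `E`. -/
def grTangentSpace (k : ℕ) (X : Set (Submodule ℂ V)) (E : Submodule ℂ V) :
    Submodule ℂ (E →ₗ[ℂ] V ⧸ E) :=
  Submodule.span ℂ {h | ∃ γ : ℂ → Submodule ℂ V,
    (∀ᶠ t in nhds (0 : ℂ), γ t ∈ X) ∧ HasGrVelocity k γ E h}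

/-- `f : ℙ¹ → X ⊆ Gr(k, V)`, written `[s : t] ↦ f s t`, is a morphism of degree `d` with respect
to the Plücker polarization: its Plücker vector `p(s, t) ∈ ⋀^k V` is homogeneous of
degree `d` in `(s, t)` and has no zero apart from `(0, 0)`. -/
def IsRationalCurve (k d : ℕ) (X : Set (Submodule ℂ V)) (f : ℂ → ℂ → Submodule ℂ V) : Prop :=
  ∃ p : Fin (d + 1) → ⋀[ℂ]^k V, ∀ s t : ℂ, (s ≠ 0 ∨ t ≠ 0) →
    f s t ∈ X ∧ ∃ w : Fin k → V, LinearIndependent ℂ w ∧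
      Submodule.span ℂ (Set.range w) = f s t ∧
      ∑ i : Fin (d + 1), (s ^ (d - (i : ℕ)) * t ^ (i : ℕ)) • p i = exteriorPower.ιMulti ℂ k w

/-- `f` is a (parametrized) minimal rational curve of `X` through `E`, with `f [1 : 0] = E`: it
has the least degree among the nonconstant rational curves of `X` passing through `E`. -/
def IsMinimalRationalCurve (k : ℕ) (X : Set (Submodule ℂ V)) (E : Submodule ℂ V)
    (f : ℂ → ℂ → Submodule ℂ V) : Prop :=
  ∃ d : ℕ, 1 ≤ d ∧ IsRationalCurve k d X f ∧ f 1 0 = E ∧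
    ∀ (d' : ℕ) (g : ℂ → ℂ → Submodule ℂ V),
      1 ≤ d' → IsRationalCurve k d' X g → g 1 0 = E → d ≤ d'

/-- The variety of minimal rational tangents of `X` at `E`: the closure of the set of tangent
directions at `E` of the minimal rational curves of `X` through `E`. It lies in
`ℙ(T_E X) ⊆ ℙ(Hom(E, V/E))`. -/
def vmrt (k : ℕ) (X : Set (Submodule ℂ V)) (E : Submodule ℂ V) :
    Set (ℙ ℂ (E →ₗ[ℂ] V ⧸ E)) :=
  {x | ∃ (h : E →ₗ[ℂ] V ⧸ E) (hh : h ≠ 0), Projectivization.mk ℂ h hh = x ∧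
    h ∈ zariskiClosure {v | v ≠ 0 ∧ ∃ f : ℂ → ℂ → Submodule ℂ V,
      IsMinimalRationalCurve k X E f ∧ HasGrVelocity k (fun t => f 1 t) E v}}

/-- A subset of `ℙ(Hom(E, V/E))`, cut with and viewed in `ℙ(T_E X)`. -/
def inTangentSpace (k : ℕ) (X : Set (Submodule ℂ V)) (E : Submodule ℂ V)
    (A : Set (ℙ ℂ (E →ₗ[ℂ] V ⧸ E))) : Set (ℙ ℂ (grTangentSpace k X E)) :=
  Projectivization.map (grTangentSpace k X E).subtype
    (grTangentSpace k X E).injective_subtype ⁻¹' A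

/-- `C` is Zariski closed in `Gr(k, V)`: its preimage in the space of `k`-frames is cut out by
polynomial equations. -/
def IsZariskiClosedGr (k : ℕ) (C : Set (Submodule ℂ V)) : Prop :=
  ∃ P : Set ((Fin k → V) → ℂ), P ⊆ polyFun (Fin k → V) ∧
    ∀ w : Fin k → V, LinearIndependent ℂ w →
      (Submodule.span ℂ (Set.range w) ∈ C ↔ ∀ p ∈ P, p w = 0)

/-- The property `Q` holds at a general point of `Z ⊆ Gr(k, V)`: it holds on `Z \ C` for some
Zariski closed `C` such that `Z \ C` is Zariski dense in `Z`. -/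
def HoldsAtGeneralPoint (k : ℕ) (Z : Set (Submodule ℂ V)) (Q : Submodule ℂ V → Prop) : Prop :=
  ∃ C : Set (Submodule ℂ V), IsZariskiClosedGr k C ∧
    (∀ C' : Set (Submodule ℂ V), IsZariskiClosedGr k C' → Z \ C ⊆ C' → Z ⊆ C') ∧
    ∀ E ∈ Z, E ∉ C → Q E

/-! ### Symplectic Grassmannians and odd symplectic Grassmannians -/

/-- The symplectic Grassmannian `Gr_ω(k, V)` of isotropic `k`-dimensional subspaces. -/
def symplecticGr (ω : LinearMap.BilinForm ℂ V) (k : ℕ) : Set (Submodule ℂ V) :=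
  {E | Module.finrank ℂ E = k ∧ ∀ x ∈ E, ∀ y ∈ E, ω x y = 0}

/-- The basis `e₁, …, e_{2ℓ}` (indexed here by `0, …, 2ℓ - 1`) is adapted to `ω`:
`ω(e_{ℓ-i}, e_{ℓ+i+1}) = -ω(e_{ℓ+i+1}, e_{ℓ-i}) = 1` for `0 ≤ i < ℓ`, and all other `ω(e_i, e_j)`
are zero. In particular `ω` is a symplectic form. -/
def IsAdaptedBasis (ℓ : ℕ) (ω : LinearMap.BilinForm ℂ V)
    (e : Module.Basis (Fin (2 * ℓ)) ℂ V) : Prop :=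
  ∀ i j : Fin (2 * ℓ), ω (e i) (e j) =
    if (i : ℕ) + (j : ℕ) + 1 = 2 * ℓ then (if (i : ℕ) < ℓ then 1 else -1) else 0

/-- The subspace `F_j` spanned by the first `j` basis vectors. -/
def flag {n : ℕ} (e : Module.Basis (Fin n) ℂ V) (j : ℕ) : Submodule ℂ V :=
  Submodule.span ℂ {v | ∃ i : Fin n, (i : ℕ) < j ∧ v = e i}

/-- `Gr_ω(k, 2ℓ; F, F') = {E ∈ Gr_ω(k, 2ℓ) : F ⊆ E ⊆ F'}`. -/
def symplecticGrBetween (ω : LinearMap.BilinForm ℂ V) (k : ℕ) (F F' : Submodule ℂ V) :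
    Set (Submodule ℂ V) :=
  {E | E ∈ symplecticGr ω k ∧ F ≤ E ∧ E ≤ F'}

end Grassmannian

end SymplecticVMRT

end

noncomputable section

namespace SymplecticVMRT

/-! ### Calculus of holomorphic germs -/

section Calculus

variable {W W₁ W₂ W₃ : Type*} [AddCommGroup W] [Module ℂ W] [AddCommGroup W₁] [Module ℂ W₁]
  [AddCommGroup W₂] [Module ℂ W₂] [AddCommGroup W₃] [Module ℂ W₃]

/-! Write `λ ⊗ q` for the rank one map `x ↦ λ(x) q` from `E` to `V/E`. The Plücker coordinates of a
curve of degree one are affine in `t`, so its velocity has vanishing 2 × 2 minors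
(`HasGrVelocity.of_degree_one`); isotropy makes the velocity symmetric for `ω`. Hence it is `λ ⊗ v`
with `ω(v, ·)|E = cλ`, and for `Z` also `λ|F_a = 0` and `v ∈ F_{2ℓ-a-1}`. Conversely each such map
is the velocity of a pencil (`exists_pencil`). These conditions are linear and quadratic, so Zariski
closure adds no nonzero vector (`mem_zariskiClosure_iff_isLineTangent`).

The tangent space of the cone of `X` at `λ ⊗ q` is the solution space of the polarized minors: the
maps `m ⊗ q + λ ⊗ r` with `ω(r, ·)|E = cm + dλ`. Differentiating `P(ρ(t), α(t)) = 0` for each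
polarized minor `P` shows that `σ(ξ, ζ) = 0` exactly when all `P(ξ, ζ)` vanish
(`exists_isSecondFundamentalForm`). On rank one maps `P` is a product of 2 × 2 determinants, one in
`λ, m` and one in `q, r`. Testing `ζ = m ⊗ q + λ ⊗ r` against tangents `λ ⊗ v'` of the cone of `Z`,
with `v'` and `v` independent mod `E`, forces `m ∥ λ`; testing then against `l' ⊗ v + λ ⊗ c v₁`,
with `l'` and `λ` independent, forces `ζ ∈ ℂβ` (`isNondegeneratePair_vmrt`).

Enough test vectors exist as soon as `e_{a+1} ∉ E` (`IsAdaptedBasis.isNondegeneratePair`). This is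
an open condition, and it is dense because a point of `Z` containing `e_{a+1}` lies on a pencil in
`Z` whose members with `t ≠ 0` do not contain it (`IsAdaptedBasis.mem_of_diff_subset`). -/

theorem HasHolDeriv.hasDerivAt {γ : ℂ → W} {v : W} (h : HasHolDeriv γ v) (φ : Module.Dual ℂ W) :
    HasDerivAt (fun t => φ (γ t)) (φ v) 0 := by
  have h1 := (h φ).1.differentiableAt.hasDerivAt
  rwa [(h φ).2] at h1

theorem HasHolDeriv.continuousAt {γ : ℂ → W} {v : W} (h : HasHolDeriv γ v)
    (φ : Module.Dual ℂ W) : ContinuousAt (fun t => φ (γ t)) 0 :=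
  (h.hasDerivAt φ).continuousAt

theorem HasHolDeriv.of_hasDerivAt {γ : ℂ → W} {v : W}
    (h : ∀ φ : Module.Dual ℂ W, AnalyticAt ℂ (fun t => φ (γ t)) 0 ∧
      HasDerivAt (fun t => φ (γ t)) (φ v) 0) : HasHolDeriv γ v :=
  fun φ => ⟨(h φ).1, (h φ).2.deriv⟩

theorem HasHolDeriv.map {γ : ℂ → W₁} {v : W₁} (h : HasHolDeriv γ v) (f : W₁ →ₗ[ℂ] W₂) :
    HasHolDeriv (fun t => f (γ t)) (f v) :=
  fun φ => h (φ ∘ₗ f)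

theorem hasHolDeriv_const (w : W) : HasHolDeriv (fun _ : ℂ => w) 0 :=
  .of_hasDerivAt fun φ => ⟨analyticAt_const, by simpa using hasDerivAt_const (0 : ℂ) (φ w)⟩

theorem HasHolDeriv.add {γ δ : ℂ → W} {v w : W} (hγ : HasHolDeriv γ v) (hδ : HasHolDeriv δ w) :
    HasHolDeriv (fun t => γ t + δ t) (v + w) :=
  .of_hasDerivAt fun φ => by
    simp only [map_add]
    exact ⟨(hγ φ).1.add (hδ φ).1, (hγ.hasDerivAt φ).add (hδ.hasDerivAt φ)⟩

theorem hasHolDeriv_smul (w : W) : HasHolDeriv (fun t : ℂ => t • w) w :=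
  .of_hasDerivAt fun φ => by
    simp only [map_smul, smul_eq_mul]
    exact ⟨analyticAt_id.mul analyticAt_const, by
      simpa using (hasDerivAt_id (0 : ℂ)).mul_const (φ w)⟩

theorem hasHolDeriv_sq_smul (w : W) : HasHolDeriv (fun t : ℂ => t ^ 2 • w) 0 :=
  .of_hasDerivAt fun φ => by
    simp only [map_smul, smul_eq_mul]
    exact ⟨(analyticAt_id.pow 2).mul analyticAt_const, by
      simpa using (hasDerivAt_pow 2 (0 : ℂ)).mul_const (φ w)⟩

theorem hasHolDeriv_affine (w v : W) : HasHolDeriv (fun t : ℂ => w + t • v) v := by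
  simpa using (hasHolDeriv_const w).add (hasHolDeriv_smul v)

theorem hasHolDeriv_quadratic (w v z : W) :
    HasHolDeriv (fun t : ℂ => w + t • v + t ^ 2 • z) v := by
  simpa using (hasHolDeriv_affine w v).add (hasHolDeriv_sq_smul z)

/-- Holomorphy is tested on linear functionals, so the product rule is checked in coordinates: a
functional of `b x y` is a finite sum of products of coordinates of `x` and `y`. -/
theorem HasHolDeriv.map₂ [FiniteDimensional ℂ W₁] [FiniteDimensional ℂ W₂]
    (b : W₁ →ₗ[ℂ] W₂ →ₗ[ℂ] W₃) {γ : ℂ → W₁} {δ : ℂ → W₂} {v : W₁} {w : W₂}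
    (hγ : HasHolDeriv γ v) (hδ : HasHolDeriv δ w) :
    HasHolDeriv (fun t => b (γ t) (δ t)) (b v (δ 0) + b (γ 0) w) := by
  let e := Module.finBasis ℂ W₁
  let f := Module.finBasis ℂ W₂
  have key : ∀ φ : Module.Dual ℂ W₃, ∃ c : _ → _ → ℂ, ∀ x y,
      φ (b x y) = ∑ i, ∑ j, e.coord i x * f.coord j y * c i j := by
    intro φ
    refine ⟨fun i j => φ (b (e i) (f j)), fun x y => ?_⟩
    conv_lhs => rw [← e.sum_repr x, ← f.sum_repr y]
    simp only [map_sum, map_smul, LinearMap.sum_apply, LinearMap.smul_apply, smul_eq_mul,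
      Module.Basis.coord_apply, Finset.mul_sum]
    rw [Finset.sum_comm]
    exact Finset.sum_congr rfl fun i _ => Finset.sum_congr rfl fun j _ => by ring
  refine .of_hasDerivAt fun φ => ?_
  obtain ⟨c, hc⟩ := key φ
  simp only [map_add, hc]
  constructor
  · exact Finset.analyticAt_fun_sum _ fun i _ => Finset.analyticAt_fun_sum _ fun j _ =>
      (((hγ (e.coord i)).1.mul (hδ (f.coord j)).1).mul analyticAt_const)
  · simp only [← Finset.sum_add_distrib, ← add_mul]
    exact HasDerivAt.fun_sum fun i _ => HasDerivAt.fun_sum fun j _ =>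
      ((hγ.hasDerivAt (e.coord i)).mul (hδ.hasDerivAt (f.coord j))).mul_const _

theorem HasHolDeriv.unique {γ : ℂ → W} {v w : W} (h : HasHolDeriv γ v) (h' : HasHolDeriv γ w) :
    v = w := by
  rw [← sub_eq_zero, ← Module.forall_dual_apply_eq_zero_iff ℂ]
  intro φ
  rw [map_sub, ← (h φ).2, ← (h' φ).2, sub_self]

theorem HasHolDeriv.congr {γ δ : ℂ → W} {v : W} (h : HasHolDeriv γ v)
    (hγδ : ∀ᶠ t in nhds (0 : ℂ), γ t = δ t) : HasHolDeriv δ v :=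
  .of_hasDerivAt fun φ =>
    have hφ : (fun t => φ (γ t)) =ᶠ[nhds 0] fun t => φ (δ t) := hγδ.mono fun _ ht => by simp [ht]
    ⟨(h φ).1.congr hφ, (h.hasDerivAt φ).congr_of_eventuallyEq hφ.symm⟩

theorem hasHolDeriv_coe_iff {p : Submodule ℂ W} {γ : ℂ → p} {v : p} :
    HasHolDeriv (fun t => (γ t : W)) (v : W) ↔ HasHolDeriv γ v := by
  refine ⟨fun h φ => ?_, fun h => h.map p.subtype⟩
  obtain ⟨ψ, hψ⟩ := LinearMap.exists_extend φ
  have hψ' : ∀ x : p, φ x = ψ x := fun x => by rw [← hψ]; rfl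
  simpa only [hψ'] using h ψ

/-- A holomorphic germ which is eventually in a subspace has its derivative there. -/
theorem HasHolDeriv.mem {p : Submodule ℂ W} {γ : ℂ → W} {v : W} (h : HasHolDeriv γ v)
    (hγ : ∀ᶠ t in nhds (0 : ℂ), γ t ∈ p) : v ∈ p := by
  by_contra hv
  obtain ⟨f, hf, hp⟩ := Submodule.exists_le_ker_of_notMem hv
  refine hf ((h.map f).unique ((hasHolDeriv_const 0).congr ?_))
  filter_upwards [hγ] with t ht
  exact (hp ht).symm

end Calculus

/-! ### Curves of degree one in a Grassmannian -/

section DegreeOne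

theorem det_updateRow_one {k : ℕ} (i : Fin k) (r : Fin k → ℂ) :
    ((1 : Matrix (Fin k) (Fin k) ℂ).updateRow i r).det = r i := by
  rw [← Matrix.cramer_transpose_apply, Matrix.transpose_one, Matrix.cramer_one]
  rfl

/-- The matrix is `1 + U * B` with `U * B` factoring through `ℂ²`, and `det (1 + U * B) = det (1 + B
* U)` is a 2 × 2 determinant. -/
theorem det_updateRow_updateRow_one {k : ℕ} {i j : Fin k} (hij : i ≠ j) (r s : Fin k → ℂ) :
    (((1 : Matrix (Fin k) (Fin k) ℂ).updateRow i r).updateRow j s).det =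
      r i * s j - r j * s i := by
  let U : Matrix (Fin k) (Fin 2) ℂ :=
    Matrix.of fun a => ![if a = i then 1 else 0, if a = j then 1 else 0]
  let B : Matrix (Fin 2) (Fin k) ℂ :=
    Matrix.of ![fun c => r c - if i = c then 1 else 0, fun c => s c - if j = c then 1 else 0]
  have h : ((1 : Matrix (Fin k) (Fin k) ℂ).updateRow i r).updateRow j s = 1 + U * B := by
    ext a c
    by_cases ha : a = j
    · subst ha
      simp [U, B, Matrix.updateRow_apply, Matrix.mul_apply, Matrix.one_apply, hij.symm]
    · by_cases hb : a = i
      · subst hb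
        simp [U, B, Matrix.updateRow_apply, Matrix.mul_apply, Matrix.one_apply, ha]
      · simp [U, B, Matrix.updateRow_apply, Matrix.mul_apply, Matrix.one_apply, ha, hb]
  rw [h, Matrix.det_one_add_mul_comm, Matrix.det_fin_two]
  simp only [Matrix.add_apply, Matrix.mul_apply]
  simp [U, B, hij, hij.symm]

variable {V : Type*} [AddCommGroup V] [Module ℂ V]

/-- The Plücker coordinate of the frame `w` given by `k` functionals. -/
def pluckerMinor {k : ℕ} (φ : Fin k → Module.Dual ℂ V) (w : Fin k → V) : ℂ :=
  (Matrix.of fun i j => φ i (w j)).det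

/-- `pluckerMinor` as a linear functional on the exterior power. -/
def pluckerFunctional {k : ℕ} (φ : Fin k → Module.Dual ℂ V) : ⋀[ℂ]^k V →ₗ[ℂ] ℂ :=
  exteriorPower.alternatingMapLinearEquiv
    ((Matrix.detRowAlternating (R := ℂ) (n := Fin k)).compLinearMap (LinearMap.pi φ))

theorem pluckerFunctional_ιMulti {k : ℕ} (φ : Fin k → Module.Dual ℂ V) (w : Fin k → V) :
    pluckerFunctional φ (exteriorPower.ιMulti ℂ k w) = pluckerMinor φ w := by
  rw [pluckerFunctional, exteriorPower.alternatingMapLinearEquiv_apply_ιMulti, pluckerMinor,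
    ← Matrix.det_transpose]
  rfl

/-- Cramer's rule for frames: the coefficients of `Y` in terms of the `X i` are ratios of Plücker
coordinates. -/
theorem pluckerMinor_update {k : ℕ} (X : Fin k → Module.Dual ℂ V) (w : Fin k → V)
    (Y : Module.Dual ℂ V) (A : Fin k → ℂ) (hY : ∀ j, Y (w j) = ∑ i, A i * X i (w j)) (i : Fin k) :
    pluckerMinor (Function.update X i Y) w = A i * pluckerMinor X w := by
  have h : (Matrix.of fun a j => Function.update X i Y a (w j)) =
      (1 : Matrix (Fin k) (Fin k) ℂ).updateRow i A * Matrix.of fun a j => X a (w j) := by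
    ext a c
    by_cases ha : a = i
    · subst ha
      simp [Matrix.mul_apply, hY]
    · simp [Matrix.mul_apply, ha, Matrix.one_apply]
  rw [pluckerMinor, h, Matrix.det_mul, det_updateRow_one, pluckerMinor]

theorem pluckerMinor_update_update {k : ℕ} (X : Fin k → Module.Dual ℂ V) (w : Fin k → V)
    (Y Y' : Module.Dual ℂ V) (A A' : Fin k → ℂ) (hY : ∀ j, Y (w j) = ∑ i, A i * X i (w j))
    (hY' : ∀ j, Y' (w j) = ∑ i, A' i * X i (w j)) {i i' : Fin k} (hi : i ≠ i') :
    pluckerMinor (Function.update (Function.update X i Y) i' Y') w =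
      (A i * A' i' - A i' * A' i) * pluckerMinor X w := by
  have h : (Matrix.of fun a j => Function.update (Function.update X i Y) i' Y' a (w j)) =
      ((1 : Matrix (Fin k) (Fin k) ℂ).updateRow i A).updateRow i' A' *
        Matrix.of fun a j => X a (w j) := by
    ext a c
    by_cases ha : a = i'
    · subst ha
      simp [Matrix.mul_apply, hY']
    · by_cases hb : a = i
      · subst hb
        simp [Matrix.mul_apply, hY, ha]
      · simp [Matrix.mul_apply, ha, hb, Matrix.one_apply]
  rw [pluckerMinor, h, Matrix.det_mul, det_updateRow_updateRow_one hi, pluckerMinor]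

theorem exists_dual_family {ι : Type*} [Fintype ι] [DecidableEq ι] {x : ι → V}
    (hx : LinearIndependent ℂ x) :
    ∃ X : ι → Module.Dual ℂ V, ∀ i j, X i (x j) = if i = j then 1 else 0 := by
  obtain ⟨g, hg⟩ := LinearMap.exists_leftInverse_of_injective (Finsupp.linearCombination ℂ x)
    (LinearMap.ker_eq_bot.2 hx)
  refine ⟨fun i => Finsupp.lapply i ∘ₗ g, fun i j => ?_⟩
  have h := LinearMap.congr_fun hg (Finsupp.single j 1)
  simp only [LinearMap.comp_apply, Finsupp.linearCombination_single, one_smul,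
    LinearMap.id_apply] at h
  simp [h, Finsupp.single_apply, eq_comm]

/-- Where the minor does not vanish, the functionals `X i` span the dual of the frame's span. -/
theorem exists_coeff_of_pluckerMinor_ne_zero {k : ℕ} {X : Fin k → Module.Dual ℂ V}
    {w : Fin k → V} (h : pluckerMinor X w ≠ 0) (Y : Module.Dual ℂ V) :
    ∃ A : Fin k → ℂ, ∀ j, Y (w j) = ∑ i, A i * X i (w j) := by
  let M : Matrix (Fin k) (Fin k) ℂ := Matrix.of fun i j => X i (w j)
  have hM : IsUnit M.det := isUnit_iff_ne_zero.2 h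
  refine ⟨Matrix.vecMul (fun j => Y (w j)) M⁻¹, fun j => ?_⟩
  have h1 : Matrix.vecMul (Matrix.vecMul (fun j => Y (w j)) M⁻¹) M = fun j => Y (w j) := by
    rw [Matrix.vecMul_vecMul, Matrix.nonsing_inv_mul _ hM, Matrix.vecMul_one]
  exact (congr_fun h1 j).symm

theorem eq_of_mem_span_range {ι : Type*} {w : ι → V} {f g : Module.Dual ℂ V}
    (h : ∀ j, f (w j) = g (w j)) {x : V} (hx : x ∈ Submodule.span ℂ (Set.range w)) : f x = g x := by
  refine LinearMap.eqOn_span (f := f) (g := g) ?_ hx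
  rintro _ ⟨j, rfl⟩
  exact h j

/-- A kernel vector of the matrix gives a combination of the `w j` killed by every `X i`; lying in
the span of `x`, it is zero, against independence of `w`. -/
theorem pluckerMinor_ne_zero_of_dual {k : ℕ} {X : Fin k → Module.Dual ℂ V} {x w : Fin k → V}
    (hX : ∀ i j, X i (x j) = if i = j then 1 else 0) (hw : LinearIndependent ℂ w)
    (hspan : Submodule.span ℂ (Set.range w) = Submodule.span ℂ (Set.range x)) :
    pluckerMinor X w ≠ 0 := by
  intro h0
  obtain ⟨c, hc, hc0⟩ := Matrix.exists_mulVec_eq_zero_iff.2 h0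
  have hz : ∑ j, c j • w j ∈ Submodule.span ℂ (Set.range x) := by
    rw [← hspan]
    exact Submodule.sum_mem _ fun j _ =>
      Submodule.smul_mem _ _ (Submodule.subset_span (Set.mem_range_self j))
  obtain ⟨d, hd⟩ := (Submodule.mem_span_range_iff_exists_fun ℂ).1 hz
  have hXz : ∀ i, X i (∑ j, c j • w j) = 0 := fun i => by
    have := congr_fun hc0 i
    simp only [Matrix.mulVec, dotProduct, Matrix.of_apply, Pi.zero_apply] at this
    simp only [map_sum, map_smul, smul_eq_mul]
    rw [← this]
    exact Finset.sum_congr rfl fun j _ => mul_comm _ _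
  have hd0 : ∀ i, d i = 0 := fun i => by
    have := hXz i
    rw [← hd] at this
    simpa [hX] using this
  refine hc (funext fun i => Fintype.linearIndependent_iff.1 hw c ?_ i)
  rw [← hd]
  simp [hd0]

/-- The velocity of a curve of Plücker degree one has rank at most one, and kills the vectors which
stay in the moving subspace. -/
theorem HasGrVelocity.of_degree_one {k : ℕ} {X : Set (Submodule ℂ V)}
    {f : ℂ → ℂ → Submodule ℂ V} (hf : IsRationalCurve k 1 X f) {E : Submodule ℂ V}
    {h : E →ₗ[ℂ] V ⧸ E} (hv : HasGrVelocity k (fun t => f 1 t) E h) :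
    (∀ (x x' : E) (y y' : Module.Dual ℂ (V ⧸ E)), y (h x) * y' (h x') = y (h x') * y' (h x)) ∧
      ∀ x : E, (∀ t, (x : V) ∈ f 1 t) → h x = 0 := by
  obtain ⟨hE, w, w', hw, hw', hh⟩ := hv
  obtain ⟨p, hp⟩ := hf
  choose u hu using fun t : ℂ => (hp 1 t (Or.inl one_ne_zero)).2
  have hEu : Submodule.span ℂ (Set.range (u 0)) = E := (hu 0).2.1.trans hE
  obtain ⟨hw0, hwE⟩ := hw.self_of_nhds
  have hwE : Submodule.span ℂ (Set.range (w 0)) = E := hwE.trans hE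
  obtain ⟨D, hD⟩ := exists_dual_family hw0
  -- the minors are affine functions of `t`
  have haff : ∀ φ : Fin k → Module.Dual ℂ V, ∃ c d : ℂ, ∀ t, pluckerMinor φ (u t) = c + t * d := by
    intro φ
    refine ⟨pluckerFunctional φ (p 0), pluckerFunctional φ (p 1), fun t => ?_⟩
    rw [← pluckerFunctional_ιMulti, ← (hu t).2.2]
    simp [Fin.sum_univ_two]
  obtain ⟨c, d, hcd⟩ := haff D
  have hc : c ≠ 0 := by
    have := pluckerMinor_ne_zero_of_dual hD (hu 0).1 (hEu.trans hwE.symm)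
    simpa [hcd] using this
  have hne : ∀ᶠ t in nhds (0 : ℂ), c + t * d ≠ 0 := by
    have : ContinuousAt (fun t : ℂ => c + t * d) 0 := by fun_prop
    exact this.eventually_ne (by simpa using hc)
  have hmem0 : ∀ j, u 0 j ∈ E := fun j => hEu ▸ Submodule.subset_span (Set.mem_range_self j)
  have hwmem : ∀ j, w 0 j ∈ E := fun j => hwE ▸ Submodule.subset_span (Set.mem_range_self j)
  -- coefficients along the curve of functionals vanishing on `E`
  have hcoef : ∀ Y : Module.Dual ℂ V, (∀ z ∈ E, Y z = 0) → ∃ a : Fin k → ℂ,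
      ∀ t, c + t * d ≠ 0 → ∀ j, Y (u t j) = ∑ i, (a i * t / (c + t * d)) * D i (u t j) := by
    intro Y hY
    choose c' d' hcd' using fun i => haff (Function.update D i Y)
    refine ⟨d', fun t ht j => ?_⟩
    have hA : ∀ s, c + s * d ≠ 0 → ∃ A : Fin k → ℂ,
        (∀ j, Y (u s j) = ∑ i, A i * D i (u s j)) ∧ ∀ i, c' i + s * d' i = A i * (c + s * d) := by
      intro s hs
      obtain ⟨A, hA⟩ := exists_coeff_of_pluckerMinor_ne_zero (X := D) (w := u s)
        (by rwa [hcd]) Y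
      exact ⟨A, hA, fun i => by rw [← hcd', pluckerMinor_update D (u s) Y A hA, hcd]⟩
    -- `Y` vanishes on the frame at `t = 0`, so the affine function `c' i + t * d' i` has no
    -- constant term.
    have hc' : ∀ i, c' i = 0 := fun i => by
      have h0 : pluckerMinor (Function.update D i Y) (u 0) = 0 := by
        rw [pluckerMinor_update D (u 0) Y 0 (fun j => by simp [hY _ (hmem0 j)])]
        simp
      simpa [hcd'] using h0
    obtain ⟨A, hA, hA'⟩ := hA t ht
    rw [hA]
    refine Finset.sum_congr rfl fun i _ => ?_
    congr 1
    have := hA' i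
    rw [hc', zero_add] at this
    rw [eq_div_iff ht, ← this, mul_comm]
  -- Two nonzero parameters, `t` and `2t`, avoiding the zero of `c + s * d`; together they separate
  -- the linear from the quadratic terms in `hminor`.
  obtain ⟨t, ht0, ht1, ht2⟩ : ∃ t : ℂ, t ≠ 0 ∧ c + t * d ≠ 0 ∧ c + (2 * t) * d ≠ 0 := by
    by_cases hd : d = 0
    · exact ⟨1, one_ne_zero, by simpa [hd] using hc, by simpa [hd] using hc⟩
    · refine ⟨c / d, div_ne_zero hc hd, ?_, ?_⟩
      · have : c + c / d * d = 2 * c := by field_simp; ring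
        rw [this]
        exact mul_ne_zero two_ne_zero hc
      · have : c + 2 * (c / d) * d = 3 * c := by field_simp; ring
        rw [this]
        exact mul_ne_zero three_ne_zero hc
  -- Replacing two rows produces the 2 × 2 minor of `a, a'` times `t² / (c + t d)`, yet this Plücker
  -- coordinate is affine in `t`. That is possible only if the minor is zero.
  have hminor : ∀ (Y Y' : Module.Dual ℂ V) (a a' : Fin k → ℂ), (∀ z ∈ E, Y z = 0) →
      (∀ z ∈ E, Y' z = 0) →
      (∀ t, c + t * d ≠ 0 → ∀ j, Y (u t j) = ∑ i, (a i * t / (c + t * d)) * D i (u t j)) →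
      (∀ t, c + t * d ≠ 0 → ∀ j, Y' (u t j) = ∑ i, (a' i * t / (c + t * d)) * D i (u t j)) →
      ∀ i i', a i * a' i' = a i' * a' i := by
    intro Y Y' a a' hY hY' ha ha' i i'
    by_cases hi : i = i'
    · rw [hi]
    obtain ⟨b₀, b₁, hb⟩ := haff (Function.update (Function.update D i Y) i' Y')
    have hq : ∀ t, c + t * d ≠ 0 →
        (b₀ + t * b₁) * (c + t * d) = (a i * a' i' - a i' * a' i) * t ^ 2 := by
      intro t ht
      rw [← hb, pluckerMinor_update_update D (u t) Y Y' _ _ (ha t ht) (ha' t ht) hi, hcd]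
      field_simp
    have hb0 : b₀ = 0 := by
      have := hq 0 (by simpa using hc)
      simpa [hc] using this
    have e1 := hq t ht1
    have e2 := hq (2 * t) ht2
    rw [hb0, zero_add] at e1 e2
    have hb1 : b₁ = 0 := by
      have : t * b₁ * c * 2 = 0 := by linear_combination 4 * e1 - e2
      simpa [ht0, hc] using this
    rw [hb1] at e1
    have : a i * a' i' - a i' * a' i = 0 := by simpa [ht0] using e1.symm
    exact sub_eq_zero.1 this
  -- Along the frame, `Y` equals `t` times a function differentiable at `0`, so its derivative there
  -- is the value of that function.
  have hvel : ∀ (Y : Module.Dual ℂ (V ⧸ E)) (a : Fin k → ℂ),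
      (∀ t, c + t * d ≠ 0 → ∀ j,
        (Y ∘ₗ E.mkQ) (u t j) = ∑ i, (a i * t / (c + t * d)) * D i (u t j)) →
      ∀ j, Y (h ⟨w 0 j, hwmem j⟩) = a j / c := by
    intro Y a ha j
    have h1 := (hw' j).hasDerivAt (Y ∘ₗ E.mkQ)
    have hg : DifferentiableAt ℂ (fun t => (∑ i, a i * D i (w t j)) / (c + t * d)) 0 := by
      refine DifferentiableAt.div ?_ (by fun_prop) (by simpa using hc)
      exact DifferentiableAt.fun_sum fun i _ =>
        ((hw' j).hasDerivAt (D i)).differentiableAt.const_mul _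
    have h2 := (hasDerivAt_id (0 : ℂ)).mul hg.hasDerivAt
    have h3 : (fun t => (Y ∘ₗ E.mkQ) (w t j)) =ᶠ[nhds 0]
        (id * fun t : ℂ => (∑ i, a i * D i (w t j)) / (c + t * d)) := by
      filter_upwards [hw, hne] with t ht ht'
      have hmem : w t j ∈ Submodule.span ℂ (Set.range (u t)) := by
        rw [(hu t).2.1, ← ht.2]
        exact Submodule.subset_span (Set.mem_range_self j)
      have := eq_of_mem_span_range (f := Y ∘ₗ E.mkQ)
        (g := ∑ i, (a i * t / (c + t * d)) • D i) (fun j => by simpa using ha t ht' j) hmem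
      rw [this]
      simp only [LinearMap.sum_apply, LinearMap.smul_apply, smul_eq_mul, Pi.mul_apply, id,
        Finset.mul_sum, Finset.sum_div]
      exact Finset.sum_congr rfl fun i _ => by ring
    have h4 := (h2.congr_of_eventuallyEq h3).unique h1
    rw [hh j (hwmem j)]
    simp only [LinearMap.comp_apply] at h4
    rw [← h4]
    simp [hD]
  have hexp : ∀ z : E, ∃ r : Fin k → ℂ, z = ∑ j, r j • (⟨w 0 j, hwmem j⟩ : E) := by
    intro z
    have hz : (z : V) ∈ Submodule.span ℂ (Set.range (w 0)) := hwE ▸ z.2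
    obtain ⟨r, hr⟩ := (Submodule.mem_span_range_iff_exists_fun ℂ).1 hz
    exact ⟨r, Subtype.ext (by simp [← hr])⟩
  have hvan : ∀ Y : Module.Dual ℂ (V ⧸ E), ∀ z ∈ E, (Y ∘ₗ E.mkQ) z = 0 := fun Y z hz => by
    simp [(Submodule.Quotient.mk_eq_zero E).2 hz]
  have hval : ∀ (Y : Module.Dual ℂ (V ⧸ E)) (a : Fin k → ℂ),
      (∀ j, Y (h ⟨w 0 j, hwmem j⟩) = a j / c) → ∀ r : Fin k → ℂ,
      Y (h (∑ j, r j • (⟨w 0 j, hwmem j⟩ : E))) = ∑ j, r j * (a j / c) := by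
    intro Y a hYa r
    simp only [map_sum, map_smul, hYa, smul_eq_mul]
  constructor
  · intro x x' y y'
    obtain ⟨a, ha⟩ := hcoef _ (hvan y)
    obtain ⟨a', ha'⟩ := hcoef _ (hvan y')
    have hm := hminor _ _ a a' (hvan y) (hvan y') ha ha'
    obtain ⟨r, hr⟩ := hexp x
    obtain ⟨r', hr'⟩ := hexp x'
    rw [hr, hr', hval y a (hvel y a ha), hval y a (hvel y a ha), hval y' a' (hvel y' a' ha'),
      hval y' a' (hvel y' a' ha'), Finset.sum_mul_sum, Finset.sum_mul_sum, Finset.sum_comm]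
    refine Finset.sum_congr rfl fun i _ => Finset.sum_congr rfl fun j _ => ?_
    have := hm i j
    field_simp
    linear_combination (-(r j * r' i)) * this
  · intro x hx
    rw [← Module.forall_dual_apply_eq_zero_iff ℂ]
    intro y
    obtain ⟨a, ha⟩ := hcoef _ (hvan y)
    obtain ⟨r, hr⟩ := hexp x
    have hDx : ∀ i, D i x = r i := fun i => by
      rw [hr]
      simp [hD]
    have hmem : (x : V) ∈ Submodule.span ℂ (Set.range (u t)) := by
      rw [(hu t).2.1]
      exact hx t
    -- As `x` lies both in `E` and in `f 1 t`, the coefficient formula at this single `t ≠ 0` gives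
    -- zero; it is a nonzero multiple of `y (h x)`.
    have h1 := eq_of_mem_span_range (f := y ∘ₗ E.mkQ)
      (g := ∑ i, (a i * t / (c + t * d)) • D i) (fun j => by simpa using ha t ht1 j) hmem
    rw [hvan y x x.2] at h1
    simp only [LinearMap.sum_apply, LinearMap.smul_apply, smul_eq_mul, hDx] at h1
    rw [hr, hval y a (hvel y a ha)]
    have h2 : (t / (c + t * d) * c) * ∑ j, r j * (a j / c) =
        ∑ i, a i * t / (c + t * d) * r i := by
      rw [Finset.mul_sum]
      exact Finset.sum_congr rfl fun i _ => by field_simp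
    rw [← h1] at h2
    exact (mul_eq_zero.1 h2).resolve_left (mul_ne_zero (div_ne_zero ht0 ht1) hc)

end DegreeOne

/-! ### Lines in spaces of isotropic subspaces -/

section Lines

variable {V : Type*} [AddCommGroup V] [Module ℂ V]

/-- The map `V/E → E*` induced by `ω`, for `E` isotropic. -/
def quotPairing (ω : LinearMap.BilinForm ℂ V) (E : Submodule ℂ V)
    (hE : ∀ x ∈ E, ∀ y ∈ E, ω x y = 0) : V ⧸ E →ₗ[ℂ] Module.Dual ℂ E :=
  E.liftQ (E.dualRestrict ∘ₗ ω) fun x hx => LinearMap.ext fun y => hE x hx y y.2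

@[simp]
theorem quotPairing_mkQ {ω : LinearMap.BilinForm ℂ V} {E : Submodule ℂ V}
    (hE : ∀ x ∈ E, ∀ y ∈ E, ω x y = 0) (v : V) (x : E) :
    quotPairing ω E hE (E.mkQ v) x = ω v x := rfl

/-- The rank one tangent vectors `λ ⊗ v` at `E` of the space of isotropic subspaces between
`F` and `F'`. -/
def IsLineTangent (ω : LinearMap.BilinForm ℂ V) (F F' E : Submodule ℂ V)
    (h : E →ₗ[ℂ] V ⧸ E) : Prop :=
  h ≠ 0 ∧ ∃ (l : Module.Dual ℂ E) (v : V), v ∈ F' ∧ (∀ x : E, (x : V) ∈ F → l x = 0) ∧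
    (∃ c : ℂ, ∀ x : E, ω v x = c * l x) ∧ h = l.smulRight (E.mkQ v)

/-- In the pencil defined by `l` only `x₀` moves; `b` spans the fixed hyperplane `ker l`. -/
theorem exists_adapted_frame {E : Submodule ℂ V} [FiniteDimensional ℂ E] {m : ℕ}
    (hE : Module.finrank ℂ E = m + 1) {l : Module.Dual ℂ E} (hl : l ≠ 0) :
    ∃ (x₀ : E) (b : Fin m → V), l x₀ = 1 ∧ LinearIndependent ℂ b ∧
      Submodule.span ℂ (Set.range b) = (LinearMap.ker l).map E.subtype := by
  obtain ⟨z, hz⟩ : ∃ z, l z ≠ 0 := by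
    by_contra! h
    exact hl (LinearMap.ext h)
  have hker : Module.finrank ℂ (LinearMap.ker l) = m := by
    have := Module.Dual.finrank_ker_add_one_of_ne_zero hl
    omega
  let B := Module.finBasisOfFinrankEq ℂ (LinearMap.ker l) hker
  let g : LinearMap.ker l →ₗ[ℂ] V := E.subtype ∘ₗ (LinearMap.ker l).subtype
  have hg : LinearMap.ker g = ⊥ :=
    LinearMap.ker_eq_bot.2 (E.injective_subtype.comp (LinearMap.ker l).injective_subtype)
  refine ⟨(l z)⁻¹ • z, g ∘ B, by simp [hz], B.linearIndependent.map' g hg, ?_⟩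
  rw [Set.range_comp, Submodule.span_image, B.span_eq, Submodule.map_top, LinearMap.range_comp,
    Submodule.range_subtype]

/-- The pencil of subspaces `E_t = {x + t λ(x) v}`. -/
theorem exists_pencil {ω : LinearMap.BilinForm ℂ V} (hω : ∀ x y, ω x y = -ω y x) {k : ℕ}
    {F F' E : Submodule ℂ V} [FiniteDimensional ℂ E] (hE : E ∈ symplecticGrBetween ω k F F')
    {l : Module.Dual ℂ E} (hl : l ≠ 0) {v : V} (hvE : v ∉ E) (hv : v ∈ F')
    (hF : ∀ x : E, (x : V) ∈ F → l x = 0) {c : ℂ} (hc : ∀ x : E, ω v x = c * l x) :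
    ∃ (f : ℂ → ℂ → Submodule ℂ V) (x x' : Fin k → V),
      IsRationalCurve k 1 (symplecticGrBetween ω k F F') f ∧ f 1 0 = E ∧
      HasGrVelocity k (fun t => f 1 t) E (l.smulRight (E.mkQ v)) ∧
      (∀ t : ℂ, LinearIndependent ℂ (x + t • x') ∧
        Submodule.span ℂ (Set.range (x + t • x')) = f 1 t) ∧
      ∀ t : ℂ, t ≠ 0 → ∀ u : E, l u ≠ 0 → (u : V) ∉ f 1 t := by
  obtain ⟨⟨hfin, hiso⟩, hFE, hEF⟩ := hE
  obtain ⟨m, rfl⟩ : ∃ m, k = m + 1 := by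
    refine Nat.exists_eq_succ_of_ne_zero fun hk => hl ?_
    have : Subsingleton E := Module.finrank_zero_iff.1 (hfin.trans hk)
    exact LinearMap.ext fun x => by rw [Subsingleton.elim x 0]; simp
  obtain ⟨x₀, b, hx₀, hb, hspan⟩ := exists_adapted_frame hfin hl
  set K := (LinearMap.ker l).map E.subtype with hK
  have hKE : K ≤ E := Submodule.map_subtype_le _ _
  have hKl : ∀ z : E, (z : V) ∈ K ↔ l z = 0 := fun z => by
    simp [hK]
  have hKv : ∀ z ∈ K, ω v z = 0 := fun z hz => by
    rw [hc ⟨z, hKE hz⟩, (hKl ⟨z, hKE hz⟩).1 hz, mul_zero]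
  have hvv : ω v v = 0 := by
    have := hω v v
    have h2 : (2 : ℂ) * ω v v = 0 := by linear_combination this
    simpa using h2
  have hnot : ∀ s t : ℂ, s ≠ 0 ∨ t ≠ 0 → s • (x₀ : V) + t • v ∉ K := by
    intro s t hst h
    have ht : t = 0 := by
      by_contra ht
      refine hvE ?_
      have h1 : t • v ∈ E := by
        have := E.sub_mem (hKE h) (E.smul_mem s x₀.2)
        simpa using this
      exact (Submodule.smul_mem_iff E ht).1 h1
    have hs : s ≠ 0 := hst.resolve_right (not_not.2 ht)
    rw [ht, zero_smul, add_zero, ← Submodule.coe_smul, hKl, map_smul, hx₀] at h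
    simp [hs] at h
  let w : ℂ → ℂ → Fin (m + 1) → V := fun s t => Fin.cons (s • (x₀ : V) + t • v) b
  have hwspan : ∀ s t, Submodule.span ℂ (Set.range (w s t)) =
      Submodule.span ℂ {s • (x₀ : V) + t • v} ⊔ K := fun s t => by
    rw [Fin.range_cons, Submodule.span_insert, hspan]
  have hwli : ∀ s t : ℂ, s ≠ 0 ∨ t ≠ 0 → LinearIndependent ℂ (w s t) := fun s t hst => by
    rw [linearIndependent_finCons]
    exact ⟨hb, by rw [hspan]; exact hnot s t hst⟩
  have hE0 : Submodule.span ℂ {(1 : ℂ) • (x₀ : V) + (0 : ℂ) • v} ⊔ K = E := by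
    rw [one_smul, zero_smul, add_zero]
    refine le_antisymm (sup_le ((Submodule.span_singleton_le_iff_mem _ _).2 x₀.2) hKE) ?_
    intro z hz
    refine Submodule.mem_sup.2 ⟨l ⟨z, hz⟩ • x₀, Submodule.smul_mem _ _
      (Submodule.mem_span_singleton_self _), z - l ⟨z, hz⟩ • x₀, ?_, by simp⟩
    have : l (⟨z, hz⟩ - l ⟨z, hz⟩ • x₀) = 0 := by simp [hx₀]
    exact (hKl _).2 this
  have hmem : ∀ s t : ℂ, s ≠ 0 ∨ t ≠ 0 → Submodule.span ℂ {s • (x₀ : V) + t • v} ⊔ K ∈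
      symplecticGrBetween ω (m + 1) F F' := by
    intro s t hst
    refine ⟨⟨?_, ?_⟩, ?_, ?_⟩
    · rw [← hwspan, finrank_span_eq_card (hwli s t hst), Fintype.card_fin]
    · intro y hy z hz
      obtain ⟨y₁, hy₁, y₂, hy₂, rfl⟩ := Submodule.mem_sup.1 hy
      obtain ⟨z₁, hz₁, z₂, hz₂, rfl⟩ := Submodule.mem_sup.1 hz
      obtain ⟨p, rfl⟩ := Submodule.mem_span_singleton.1 hy₁
      obtain ⟨q, rfl⟩ := Submodule.mem_span_singleton.1 hz₁
      simp only [map_add, map_smul, LinearMap.add_apply, LinearMap.smul_apply, smul_eq_mul,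
        hiso _ x₀.2 _ x₀.2, hiso _ x₀.2 _ (hKE hz₂), hiso _ (hKE hy₂) _ x₀.2,
        hiso _ (hKE hy₂) _ (hKE hz₂), hKv _ hz₂, hvv, hω y₂ v, hKv _ hy₂]
      -- `ω(v, x₀)` need not vanish: the two cross terms `s t ω(x₀, v)` and `t s ω(v, x₀)` cancel.
      rw [hω v x₀]
      ring
    · intro z hz
      exact Submodule.mem_sup_right ((hKl ⟨z, hFE hz⟩).2 (hF ⟨z, hFE hz⟩ hz))
    · refine sup_le ((Submodule.span_singleton_le_iff_mem _ _).2 ?_) (hKE.trans hEF)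
      exact F'.add_mem (F'.smul_mem _ (hEF x₀.2)) (F'.smul_mem _ hv)
  have hw1 : ∀ t : ℂ, (Fin.cons (x₀ : V) b : Fin (m + 1) → V) +
      t • (Fin.cons v 0 : Fin (m + 1) → V) = w 1 t := fun t => by
    ext i
    refine Fin.cases ?_ (fun j => ?_) i <;> simp [w]
  refine ⟨fun s t => Submodule.span ℂ {s • (x₀ : V) + t • v} ⊔ K, Fin.cons (x₀ : V) b,
    Fin.cons v 0, ?_, hE0, ?_, ?_, ?_⟩
  -- Only the first frame vector depends on `(s, t)`, and linearly, so the Plücker vector has degree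
  -- one.
  · refine ⟨![exteriorPower.ιMulti ℂ (m + 1) (Fin.cons (x₀ : V) b),
      exteriorPower.ιMulti ℂ (m + 1) (Fin.cons v b)], fun s t hst =>
      ⟨hmem s t hst, w s t, hwli s t hst, hwspan s t, ?_⟩⟩
    have h1 := (exteriorPower.ιMulti ℂ (m + 1) (M := V)).toMultilinearMap.cons_add b
      (s • (x₀ : V)) (t • v)
    have h2 := (exteriorPower.ιMulti ℂ (m + 1) (M := V)).toMultilinearMap.cons_smul b s (x₀ : V)
    have h3 := (exteriorPower.ιMulti ℂ (m + 1) (M := V)).toMultilinearMap.cons_smul b t v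
    simp only [AlternatingMap.coe_multilinearMap] at h1 h2 h3
    simp only [w]
    rw [h1, h2, h3]
    simp
  · refine ⟨hE0, fun t => w 1 t, Fin.cons v 0, .of_forall fun t =>
      ⟨hwli 1 t (Or.inl one_ne_zero), hwspan 1 t⟩, fun i => ?_, fun i => ?_⟩
    · simp only [← hw1]
      exact hasHolDeriv_affine _ _
    · refine Fin.cases (fun hi => ?_) (fun j hi => ?_) i
      · simp only [w, Fin.cons_zero, one_smul, zero_smul, add_zero] at hi ⊢
        simp only [LinearMap.smulRight_apply]
        rw [show (⟨(x₀ : V), hi⟩ : E) = x₀ from rfl, hx₀, one_smul]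
      · simp only [w, Fin.cons_succ] at hi ⊢
        have : b j ∈ K := hspan ▸ Submodule.subset_span (Set.mem_range_self j)
        simp [(hKl ⟨b j, hi⟩).1 this]
  · intro t
    rw [hw1]
    exact ⟨hwli 1 t (Or.inl one_ne_zero), hwspan 1 t⟩
  -- A member with `t ≠ 0` meets `E` only in `ker l`. This moves the pencil off the subspaces
  -- containing a given `u`.
  · intro t ht u hu hmem
    obtain ⟨y, hy, z, hz, hyz⟩ := Submodule.mem_sup.1 hmem
    obtain ⟨p, rfl⟩ := Submodule.mem_span_singleton.1 hy
    have hp : p = 0 := by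
      by_contra hp
      refine hvE ?_
      have h1 : (p * t) • v ∈ E := by
        have : (p * t) • v = u - z - p • (x₀ : V) := by rw [← hyz]; module
        rw [this]
        exact E.sub_mem (E.sub_mem u.2 (hKE hz)) (E.smul_mem _ x₀.2)
      exact (Submodule.smul_mem_iff E (mul_ne_zero hp ht)).1 h1
    rw [hp, zero_smul, zero_add] at hyz
    exact hu ((hKl u).1 (hyz ▸ hz))

end Lines

/-! ### The varieties of minimal rational tangents -/

section VMRT

variable {V : Type*} [AddCommGroup V] [Module ℂ V] {ω : LinearMap.BilinForm ℂ V}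
  {F F' E : Submodule ℂ V} {k : ℕ}

theorem HasGrVelocity.exists_basis {γ : ℂ → Submodule ℂ V} {h : E →ₗ[ℂ] V ⧸ E}
    (hv : HasGrVelocity k γ E h) :
    ∃ (w : ℂ → Fin k → V) (w' : Fin k → V) (b : Module.Basis (Fin k) ℂ E),
      (∀ i, (b i : V) = w 0 i) ∧ (∀ᶠ t in nhds (0 : ℂ), ∀ i, w t i ∈ γ t) ∧
      (∀ i, HasHolDeriv (fun t => w t i) (w' i)) ∧ ∀ i, h (b i) = E.mkQ (w' i) := by
  obtain ⟨h0, w, w', hw, hw', hh⟩ := hv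
  obtain ⟨hli, hsp⟩ := hw.self_of_nhds
  rw [h0] at hsp
  have hmem : ∀ i, w 0 i ∈ E := fun i => hsp ▸ Submodule.subset_span (Set.mem_range_self i)
  have hli' : LinearIndependent ℂ fun i => (⟨w 0 i, hmem i⟩ : E) :=
    LinearIndependent.of_comp E.subtype hli
  have hsp' : ⊤ ≤ Submodule.span ℂ (Set.range fun i => (⟨w 0 i, hmem i⟩ : E)) := by
    rintro ⟨x, hx⟩ -
    rw [← hsp] at hx
    obtain ⟨c, rfl⟩ := (Submodule.mem_span_range_iff_exists_fun ℂ).1 hx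
    exact (Submodule.mem_span_range_iff_exists_fun ℂ).2 ⟨c, Subtype.ext (by simp)⟩
  refine ⟨w, w', Module.Basis.mk hli' hsp', fun i => by simp, ?_, hw', fun i => by simp [hh]⟩
  filter_upwards [hw] with t ht i
  rw [← ht.2]
  exact Submodule.subset_span (Set.mem_range_self i)

/-- Differentiate `ω(wᵢ(t), wⱼ(t)) = 0` at `t = 0` for a frame and use skew-symmetry. -/
theorem HasGrVelocity.symm_of_isotropic [FiniteDimensional ℂ V] (hω : ∀ x y, ω x y = -ω y x)
    (hE : ∀ x ∈ E, ∀ y ∈ E, ω x y = 0) {γ : ℂ → Submodule ℂ V} {h : E →ₗ[ℂ] V ⧸ E}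
    (hγ : ∀ᶠ t in nhds (0 : ℂ), ∀ x ∈ γ t, ∀ y ∈ γ t, ω x y = 0)
    (hv : HasGrVelocity k γ E h) (x y : E) :
    quotPairing ω E hE (h x) y = quotPairing ω E hE (h y) x := by
  obtain ⟨w, w', b, hb, hw, hw', hh⟩ := hv.exists_basis
  suffices quotPairing ω E hE ∘ₗ h = (quotPairing ω E hE ∘ₗ h).flip from
    LinearMap.congr_fun₂ this x y
  refine LinearMap.ext_basis b b fun i j => ?_
  simp only [LinearMap.comp_apply, LinearMap.flip_apply, hh, quotPairing_mkQ, hb]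
  have h1 := (hw' i).map₂ ω (hw' j)
  have h2 := h1.unique ((hasHolDeriv_const 0).congr (by
    filter_upwards [hγ, hw] with t ht ht'
    exact (ht _ (ht' i) _ (ht' j)).symm))
  rw [hω (w 0 i)] at h2
  exact add_neg_eq_zero.1 h2

theorem HasGrVelocity.mem_map_mkQ {γ : ℂ → Submodule ℂ V} {h : E →ₗ[ℂ] V ⧸ E}
    (hγ : ∀ᶠ t in nhds (0 : ℂ), γ t ≤ F') (hv : HasGrVelocity k γ E h) (x : E) :
    h x ∈ F'.map E.mkQ := by
  obtain ⟨w, w', b, hb, hw, hw', hh⟩ := hv.exists_basis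
  have key : ∀ i, h (b i) ∈ F'.map E.mkQ := fun i => by
    rw [hh]
    refine Submodule.mem_map_of_mem ((hw' i).mem ?_)
    filter_upwards [hγ, hw] with t ht ht'
    exact ht (ht' i)
  rw [← b.sum_repr x, map_sum]
  exact Submodule.sum_mem _ fun i _ => by
    rw [map_smul]
    exact Submodule.smul_mem _ _ (key i)

/-- Vanishing minors give `h = λ ⊗ h(x₁)` with `λ = y₀(h ·) / y₀(h x₁)`. Symmetry at `(x₁, x)` then
reads `ω(v, x) = ω(v, x₁) λ(x)`. -/
theorem isLineTangent_of_minors (hE : ∀ x ∈ E, ∀ y ∈ E, ω x y = 0)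
    {h : E →ₗ[ℂ] V ⧸ E} (h0 : h ≠ 0)
    (hs : ∀ x y, quotPairing ω E hE (h x) y = quotPairing ω E hE (h y) x)
    (hm : ∀ (x x' : E) (y y' : Module.Dual ℂ (V ⧸ E)), y (h x) * y' (h x') = y (h x') * y' (h x))
    (hF : ∀ x : E, (x : V) ∈ F → h x = 0) (hF' : ∀ x, h x ∈ F'.map E.mkQ) :
    IsLineTangent ω F F' E h := by
  obtain ⟨x₁, hx₁⟩ : ∃ x, h x ≠ 0 := by
    by_contra! hc
    exact h0 (LinearMap.ext hc)
  obtain ⟨y₀, hy₀⟩ : ∃ y : Module.Dual ℂ (V ⧸ E), y (h x₁) ≠ 0 := by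
    by_contra! hc
    exact hx₁ ((Module.forall_dual_apply_eq_zero_iff ℂ _).1 hc)
  obtain ⟨v, hv, hvx⟩ := hF' x₁
  have hrank : ∀ x, h x = (y₀ (h x) * (y₀ (h x₁))⁻¹) • h x₁ := by
    intro x
    rw [← sub_eq_zero, ← Module.forall_dual_apply_eq_zero_iff ℂ]
    intro y
    have := hm x x₁ y y₀
    simp only [map_sub, map_smul, smul_eq_mul]
    field_simp
    linear_combination this
  refine ⟨h0, (y₀ (h x₁))⁻¹ • (y₀ ∘ₗ h), v, hv, fun x hx => by simp [hF x hx],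
    ⟨ω v x₁, fun x => ?_⟩, LinearMap.ext fun x => ?_⟩
  · have h1 := hs x₁ x
    rw [hrank x, map_smul, LinearMap.smul_apply, ← hvx, quotPairing_mkQ, quotPairing_mkQ] at h1
    rw [h1, hvx]
    simp only [LinearMap.smul_apply, LinearMap.comp_apply, smul_eq_mul]
    ring
  · rw [LinearMap.smulRight_apply, hvx, hrank x]
    simp only [LinearMap.smul_apply, LinearMap.comp_apply, smul_eq_mul]
    congr 1
    field_simp

theorem ne_zero_and_notMem_of_smulRight_mkQ_ne_zero {l : Module.Dual ℂ E} {v : V}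
    (h : l.smulRight (E.mkQ v) ≠ 0) : l ≠ 0 ∧ v ∉ E := by
  refine ⟨fun hl => h (by simp [hl]), fun hv => h ?_⟩
  ext x
  simp [(Submodule.Quotient.mk_eq_zero E).2 hv]

theorem dual_mem_polyFun {W : Type*} [AddCommGroup W] [Module ℂ W] (φ : Module.Dual ℂ W) :
    (φ : W → ℂ) ∈ polyFun W :=
  Algebra.subset_adjoin ⟨φ, rfl⟩

theorem subset_zariskiClosure {W : Type*} [AddCommGroup W] [Module ℂ W] (S : Set W) :
    S ⊆ zariskiClosure S :=
  fun _ hx _ _ hS => hS _ hx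

theorem apply_eq_zero_of_mem_zariskiClosure {W : Type*} [AddCommGroup W] [Module ℂ W] {S : Set W}
    {w : W} (hw : w ∈ zariskiClosure S) (φ : Module.Dual ℂ W) (h : ∀ s ∈ S, φ s = 0) : φ w = 0 :=
  hw φ (dual_mem_polyFun φ) h

/-- The nonzero vectors in the closure of the set of tangent vectors to minimal rational curves are
the tangent vectors to lines, if there are any. -/
theorem mem_zariskiClosure_iff_isLineTangent [FiniteDimensional ℂ V]
    (hω : ∀ x y, ω x y = -ω y x) (hE : E ∈ symplecticGrBetween ω k F F')
    (hex : ∃ h, IsLineTangent ω F F' E h) {h : E →ₗ[ℂ] V ⧸ E} (h0 : h ≠ 0) :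
    h ∈ zariskiClosure {v | v ≠ 0 ∧ ∃ f : ℂ → ℂ → Submodule ℂ V,
      IsMinimalRationalCurve k (symplecticGrBetween ω k F F') E f ∧
        HasGrVelocity k (fun t => f 1 t) E v} ↔ IsLineTangent ω F F' E h := by
  have hline : ∀ h, IsLineTangent ω F F' E h → ∃ f : ℂ → ℂ → Submodule ℂ V,
      IsRationalCurve k 1 (symplecticGrBetween ω k F F') f ∧ f 1 0 = E ∧
        HasGrVelocity k (fun t => f 1 t) E h := by
    rintro h ⟨h0, l, v, hv, hl, ⟨c, hc⟩, rfl⟩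
    obtain ⟨hl0, hvE⟩ := ne_zero_and_notMem_of_smulRight_mkQ_ne_zero h0
    obtain ⟨f, -, -, h1, h2, h3, -⟩ := exists_pencil hω hE hl0 hvE hv hl hc
    exact ⟨f, h1, h2, h3⟩
  have hiso := hE.1.2
  constructor
  · intro hcl
    obtain ⟨h₁, hh₁⟩ := hex
    obtain ⟨f₁, hf₁, hf₁', -⟩ := hline h₁ hh₁
    have hspec : ∀ g ∈ {v | v ≠ 0 ∧ ∃ f : ℂ → ℂ → Submodule ℂ V,
        IsMinimalRationalCurve k (symplecticGrBetween ω k F F') E f ∧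
          HasGrVelocity k (fun t => f 1 t) E v}, ∃ f : ℂ → ℂ → Submodule ℂ V,
        IsRationalCurve k 1 (symplecticGrBetween ω k F F') f ∧
          HasGrVelocity k (fun t => f 1 t) E g := by
      rintro g ⟨-, f, ⟨d, hd, hf, -, hmin⟩, hg⟩
      -- A line through `E` exists by `hex`, so the minimal degree is one.
      obtain rfl : d = 1 := le_antisymm (hmin 1 f₁ le_rfl hf₁ hf₁') hd
      exact ⟨f, hf, hg⟩
    have hmem : ∀ {f : ℂ → ℂ → Submodule ℂ V},
        IsRationalCurve k 1 (symplecticGrBetween ω k F F') f →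
          ∀ t, f 1 t ∈ symplecticGrBetween ω k F F' := fun hf t => by
      obtain ⟨p, hp⟩ := hf
      exact (hp 1 t (Or.inl one_ne_zero)).1
    -- Each of the four conditions is the vanishing of linear or quadratic polynomials in `h`, hence
    -- passes to the Zariski closure.
    refine isLineTangent_of_minors hiso h0 (fun x y => ?_) (fun x x' y y' => ?_)
      (fun x hx => ?_) (fun x => ?_)
    · let ev : Module.Dual ℂ (E →ₗ[ℂ] V ⧸ E) :=
        LinearMap.applyₗ y ∘ₗ quotPairing ω E hiso ∘ₗ LinearMap.applyₗ x -
          LinearMap.applyₗ x ∘ₗ quotPairing ω E hiso ∘ₗ LinearMap.applyₗ y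
      refine sub_eq_zero.1 (apply_eq_zero_of_mem_zariskiClosure hcl ev fun g hg => ?_)
      obtain ⟨f, hf, hg⟩ := hspec g hg
      exact sub_eq_zero.2
        (hg.symm_of_isotropic hω hiso (.of_forall fun t => (hmem hf t).1.2) x y)
    · let ev : E → Module.Dual ℂ (V ⧸ E) → Module.Dual ℂ (E →ₗ[ℂ] V ⧸ E) :=
        fun x y => y ∘ₗ LinearMap.applyₗ x
      refine sub_eq_zero.1 (hcl (⇑(ev x y) * ⇑(ev x' y') - ⇑(ev x' y) * ⇑(ev x y'))
        (sub_mem (mul_mem (dual_mem_polyFun _) (dual_mem_polyFun _))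
          (mul_mem (dual_mem_polyFun _) (dual_mem_polyFun _))) fun g hg => ?_)
      obtain ⟨f, hf, hg⟩ := hspec g hg
      exact sub_eq_zero.2 ((hg.of_degree_one hf).1 x x' y y')
    · rw [← Module.forall_dual_apply_eq_zero_iff ℂ]
      intro y
      refine apply_eq_zero_of_mem_zariskiClosure hcl (y ∘ₗ LinearMap.applyₗ x) fun g hg => ?_
      obtain ⟨f, hf, hg⟩ := hspec g hg
      have := (hg.of_degree_one hf).2 x fun t => (hmem hf t).2.1 hx
      simp [this]
    · by_contra hx
      obtain ⟨y, hy, hyF⟩ := Submodule.exists_le_ker_of_notMem hx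
      refine hy (apply_eq_zero_of_mem_zariskiClosure hcl (y ∘ₗ LinearMap.applyₗ x) fun g hg => ?_)
      obtain ⟨f, hf, hg⟩ := hspec g hg
      exact hyF (hg.mem_map_mkQ (.of_forall fun t => (hmem hf t).2.2) x)
  · intro hh
    obtain ⟨f, hf, hf0, hfv⟩ := hline h hh
    exact subset_zariskiClosure _ ⟨h0, f, ⟨1, le_rfl, hf, hf0, fun d _ hd _ _ => hd⟩, hfv⟩

theorem IsLineTangent.smul {h : E →ₗ[ℂ] V ⧸ E} (hh : IsLineTangent ω F F' E h) {r : ℂ}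
    (hr : r ≠ 0) : IsLineTangent ω F F' E (r • h) := by
  obtain ⟨h0, l, v, hv, hl, ⟨c, hc⟩, rfl⟩ := hh
  refine ⟨smul_ne_zero hr h0, l, r • v, F'.smul_mem r hv, hl, ⟨r * c, fun x => ?_⟩, ?_⟩
  · simp [hc, mul_assoc]
  · ext x
    simp [smul_comm r]

theorem IsLineTangent.mono {h : E →ₗ[ℂ] V ⧸ E} (hh : IsLineTangent ω F F' E h) :
    IsLineTangent ω ⊥ ⊤ E h := by
  obtain ⟨h0, l, v, -, -, hc, hh⟩ := hh
  refine ⟨h0, l, v, trivial, fun x hx => ?_, hc, hh⟩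
  rw [Submodule.mem_bot, Submodule.coe_eq_zero] at hx
  rw [hx, map_zero]

theorem symplecticGr_eq_between : symplecticGr ω k = symplecticGrBetween ω k ⊥ ⊤ := by
  ext E
  simp [symplecticGrBetween]

theorem mem_vmrt_iff [FiniteDimensional ℂ V] (hω : ∀ x y, ω x y = -ω y x)
    (hE : E ∈ symplecticGrBetween ω k F F') (hex : ∃ h, IsLineTangent ω F F' E h)
    {h : E →ₗ[ℂ] V ⧸ E} (h0 : h ≠ 0) :
    Projectivization.mk ℂ h h0 ∈ vmrt k (symplecticGrBetween ω k F F') E ↔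
      IsLineTangent ω F F' E h := by
  constructor
  · rintro ⟨g, hg, hgh, hgc⟩
    obtain ⟨r, hr⟩ := (Projectivization.mk_eq_mk_iff' ℂ _ _ _ _).1 hgh.symm
    rw [mem_zariskiClosure_iff_isLineTangent hω hE hex hg] at hgc
    rw [← hr]
    exact hgc.smul fun hr0 => h0 (by rw [← hr, hr0, zero_smul])
  · intro hh
    exact ⟨h, h0, rfl, (mem_zariskiClosure_iff_isLineTangent hω hE hex h0).2 hh⟩

theorem mem_affineCone_vmrt_iff [FiniteDimensional ℂ V] (hω : ∀ x y, ω x y = -ω y x)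
    (hE : E ∈ symplecticGrBetween ω k F F') (hex : ∃ h, IsLineTangent ω F F' E h)
    {X : Set (Submodule ℂ V)} (h : grTangentSpace k X E) :
    h ∈ affineCone (inTangentSpace k X E (vmrt k (symplecticGrBetween ω k F F') E)) ↔
      IsLineTangent ω F F' E h := by
  constructor
  · rintro ⟨h0, hh⟩
    exact (mem_vmrt_iff hω hE hex (fun hc => h0 (Subtype.ext hc))).1 hh
  · intro hh
    have h0 : h ≠ 0 := fun hc => hh.1 (by rw [hc]; rfl)
    exact ⟨h0, (mem_vmrt_iff hω hE hex hh.1).2 hh⟩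

/-- Tangent vectors to lines are tangent to the space of isotropic subspaces. -/
theorem IsLineTangent.mem_grTangentSpace [FiniteDimensional ℂ V] (hω : ∀ x y, ω x y = -ω y x)
    (hE : E ∈ symplecticGrBetween ω k F F') {h : E →ₗ[ℂ] V ⧸ E}
    (hh : IsLineTangent ω F F' E h) :
    h ∈ grTangentSpace k (symplecticGrBetween ω k F F') E := by
  obtain ⟨h0, l, v, hv, hl, ⟨c, hc⟩, rfl⟩ := hh
  obtain ⟨hl0, hvE⟩ := ne_zero_and_notMem_of_smulRight_mkQ_ne_zero h0
  obtain ⟨f, -, -, ⟨p, hp⟩, -, h3, -⟩ := exists_pencil hω hE hl0 hvE hv hl hc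
  exact Submodule.subset_span
    ⟨fun t => f 1 t, .of_forall fun t => (hp 1 t (Or.inl one_ne_zero)).1, h3⟩

theorem symm_of_mem_grTangentSpace [FiniteDimensional ℂ V] (hω : ∀ x y, ω x y = -ω y x)
    (hE : ∀ x ∈ E, ∀ y ∈ E, ω x y = 0) {h : E →ₗ[ℂ] V ⧸ E}
    (hh : h ∈ grTangentSpace k (symplecticGr ω k) E) (x y : E) :
    quotPairing ω E hE (h x) y = quotPairing ω E hE (h y) x := by
  induction hh using Submodule.span_induction with
  | mem h hh =>
    obtain ⟨γ, hγ, hv⟩ := hh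
    exact hv.symm_of_isotropic hω hE (hγ.mono fun t ht => ht.2) x y
  | zero => simp
  | add g h _ _ hg hh => simp only [LinearMap.add_apply, map_add, hg, hh]
  | smul r h _ hh => simp only [LinearMap.smul_apply, map_smul, hh]

end VMRT

/-! ### The second fundamental form of a cone cut out by quadrics -/

section Quadrics

variable {W : Type*} [AddCommGroup W] [Module ℂ W] [FiniteDimensional ℂ W]

/-- The tangent spaces of an intersection of quadrics satisfy the polarized equations. -/
theorem eq_zero_of_mem_tangentSpace {P : W →ₗ[ℂ] W →ₗ[ℂ] ℂ} (hP : ∀ x y, P x y = P y x)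
    {S : Set W} (hS : ∀ x ∈ S, P x x = 0) {β h : W} (hh : h ∈ tangentSpace S β) : P h β = 0 := by
  induction hh using Submodule.span_induction with
  | mem h hh =>
    obtain ⟨α, rfl, hα, hd⟩ := hh
    have h1 := (hd.map₂ P hd).unique ((hasHolDeriv_const 0).congr
      (hα.mono fun t ht => (hS _ ht).symm))
    rw [hP (α 0)] at h1
    have h2 : (2 : ℂ) * P h (α 0) = 0 := by linear_combination h1
    simpa using h2
  | zero => simp
  | add g h _ _ hg hh => simp [hg, hh]
  | smul r h _ hh => simp [hh]

/-- If the tangent spaces of `S` are given by polarizing quadratic equations `P i x x = 0`, then the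
second fundamental form is determined by `P i (σ ξ ζ) β = -P i ξ ζ`. -/
theorem exists_isSecondFundamentalForm {ι : Type*} {P : ι → W →ₗ[ℂ] W →ₗ[ℂ] ℂ}
    (hP : ∀ i x y, P i x y = P i y x) {S : Set W} {β : W} (hβ : β ∈ S)
    (hT : ∀ α ∈ S, ∀ h, h ∈ tangentSpace S α ↔ ∀ i, P i h α = 0)
    (hmov : ∀ ξ ∈ tangentSpace S β, ∀ ζ ∈ tangentSpace S β, ∃ v, IsMovingVector S β ξ ζ v) :
    ∃ σ : tangentSpace S β →ₗ[ℂ] tangentSpace S β →ₗ[ℂ] (W ⧸ tangentSpace S β),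
      IsSecondFundamentalForm S β σ ∧ ∀ ξ ζ, σ ξ ζ = 0 ↔ ∀ i, P i ξ ζ = 0 := by
  set T := tangentSpace S β with hTdef
  let Q : W →ₗ[ℂ] ι → ℂ := LinearMap.pi fun i => (P i).flip β
  have hQ : ∀ h i, Q h i = P i h β := fun _ _ => rfl
  have hker : T = LinearMap.ker Q := by
    ext h
    rw [hTdef, hT β hβ, LinearMap.mem_ker, funext_iff]
    rfl
  -- `Q` embeds `W ⧸ T` into `ι → ℂ`. The left inverse `g` makes `σ` bilinear by construction; its
  -- values are the right ones because moving vectors place `-P i ξ ζ` in the range of `Q`.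
  obtain ⟨g, hg⟩ := LinearMap.exists_leftInverse_of_injective (T.liftQ Q hker.le)
    (Submodule.ker_liftQ_eq_bot _ _ _ hker.ge)
  have hg' : ∀ v, g (Q v) = T.mkQ v := fun v => LinearMap.congr_fun hg (T.mkQ v)
  -- Derivative at `0` of `P i (ρ t) (α t) = 0`.
  have hmv : ∀ {ξ ζ v : W}, IsMovingVector S β ξ ζ v → Q v = -fun i => P i ξ ζ := by
    rintro ξ ζ v ⟨α, ρ, ⟨rfl, hα, hdα⟩, rfl, hρ, hdρ⟩
    funext i
    have h1 := (hdρ.map₂ (P i) hdα).unique ((hasHolDeriv_const 0).congr (by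
      filter_upwards [hα, hρ] with t ht ht'
      exact ((hT _ ht _).1 ht' i).symm))
    rw [Pi.neg_apply, hQ, hP i ξ]
    exact eq_neg_of_add_eq_zero_left h1
  let σ : T →ₗ[ℂ] T →ₗ[ℂ] (W ⧸ T) := LinearMap.mk₂ ℂ (fun ξ ζ => g (-fun i => P i ξ ζ))
    (fun a b c => by
      rw [← map_add]; congr 1; funext i; simp; ring)
    (fun r a c => by
      rw [← map_smul]; congr 1; funext i; simp)
    (fun a b c => by
      rw [← map_add]; congr 1; funext i; simp; ring)
    (fun r a c => by
      rw [← map_smul]; congr 1; funext i; simp)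
  have hσ : ∀ {ξ ζ : T} {v : W}, IsMovingVector S β ξ ζ v → σ ξ ζ = T.mkQ v := fun {ξ ζ v} h => by
    rw [← hg', hmv h]
    rfl
  refine ⟨σ, fun ξ ζ y => ⟨?_, ?_⟩, fun ξ ζ => ?_⟩
  · rintro rfl
    obtain ⟨v, hv⟩ := hmov ξ ξ.2 ζ ζ.2
    exact ⟨v, hv, (hσ hv).symm⟩
  · rintro ⟨v, hv, rfl⟩
    exact hσ hv
  · obtain ⟨v, hv⟩ := hmov ξ ξ.2 ζ ζ.2
    have hvQ := hmv hv
    rw [hσ hv, Submodule.mkQ_apply, Submodule.Quotient.mk_eq_zero, hker, LinearMap.mem_ker, hvQ,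
      neg_eq_zero, funext_iff]
    rfl

end Quadrics

/-! ### The cone of tangent vectors to lines in the symplectic Grassmannian -/

section Cone

variable {V : Type*} [AddCommGroup V] [Module ℂ V] {E : Submodule ℂ V}

/-- The polarization of a `2 × 2` minor of linear maps `E → V/E`. -/
def minorForm (x x' : E) (y y' : Module.Dual ℂ (V ⧸ E)) :
    (E →ₗ[ℂ] V ⧸ E) →ₗ[ℂ] (E →ₗ[ℂ] V ⧸ E) →ₗ[ℂ] ℂ :=
  LinearMap.mk₂ ℂ
    (fun h g => y (h x) * y' (g x') + y (g x) * y' (h x') - y (h x') * y' (g x) -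
      y (g x') * y' (h x))
    (fun _ _ _ => by simp only [LinearMap.add_apply, map_add]; ring)
    (fun _ _ _ => by simp only [LinearMap.smul_apply, map_smul, smul_eq_mul]; ring)
    (fun _ _ _ => by simp only [LinearMap.add_apply, map_add]; ring)
    (fun _ _ _ => by simp only [LinearMap.smul_apply, map_smul, smul_eq_mul]; ring)

theorem minorForm_apply (x x' : E) (y y' : Module.Dual ℂ (V ⧸ E)) (h g : E →ₗ[ℂ] V ⧸ E) :
    minorForm x x' y y' h g = y (h x) * y' (g x') + y (g x) * y' (h x') - y (h x') * y' (g x) -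
      y (g x') * y' (h x) := rfl

theorem minorForm_comm (x x' : E) (y y' : Module.Dual ℂ (V ⧸ E)) (h g : E →ₗ[ℂ] V ⧸ E) :
    minorForm x x' y y' h g = minorForm x x' y y' g h := by
  simp only [minorForm_apply]
  ring

/-- The factored form `(l ∧ m)(q ∧ r)`: it vanishes when either pair is proportional, which drives
every later computation. -/
theorem minorForm_smulRight_smulRight (x x' : E) (y y' : Module.Dual ℂ (V ⧸ E))
    (l m : Module.Dual ℂ E) (q r : V ⧸ E) :
    minorForm x x' y y' (l.smulRight q) (m.smulRight r) =
      (l x * m x' - l x' * m x) * (y q * y' r - y r * y' q) := by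
  simp only [minorForm_apply, LinearMap.smulRight_apply, map_smul, smul_eq_mul]
  ring

theorem smulRight_ne_zero {l : Module.Dual ℂ E} {q : V ⧸ E} (hl : l ≠ 0) (hq : q ≠ 0) :
    l.smulRight q ≠ 0 := by
  obtain ⟨x, hx⟩ : ∃ x, l x ≠ 0 := by
    by_contra! h
    exact hl (LinearMap.ext h)
  exact fun h => smul_ne_zero hx hq (LinearMap.congr_fun h x)

theorem ne_zero_of_smulRight_ne_zero {l : Module.Dual ℂ E} {q : V ⧸ E}
    (h : l.smulRight q ≠ 0) : l ≠ 0 ∧ q ≠ 0 :=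
  ⟨fun hl => h (by simp [hl]), fun hq => h (by ext; simp [hq])⟩

theorem exists_eq_smul_of_dual_minors_eq_zero {M : Type*} [AddCommGroup M] [Module ℂ M] {q r : M}
    (hq : q ≠ 0) (h : ∀ y y' : Module.Dual ℂ M, y q * y' r - y r * y' q = 0) :
    ∃ c : ℂ, r = c • q := by
  obtain ⟨y, hy⟩ : ∃ y : Module.Dual ℂ M, y q ≠ 0 := by
    by_contra! hc
    exact hq ((Module.forall_dual_apply_eq_zero_iff ℂ _).1 hc)
  refine ⟨y r * (y q)⁻¹, ?_⟩
  rw [← sub_eq_zero, ← Module.forall_dual_apply_eq_zero_iff ℂ]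
  intro y'
  have := h y y'
  simp only [map_sub, map_smul, smul_eq_mul]
  field_simp
  linear_combination this

variable {ω : LinearMap.BilinForm ℂ V} {k : ℕ}

theorem isLineTangent_bot_top_iff (hE : ∀ x ∈ E, ∀ y ∈ E, ω x y = 0) {h : E →ₗ[ℂ] V ⧸ E} :
    IsLineTangent ω ⊥ ⊤ E h ↔ h ≠ 0 ∧ ∃ (l : Module.Dual ℂ E) (q : V ⧸ E) (c : ℂ),
      quotPairing ω E hE q = c • l ∧ h = l.smulRight q := by
  constructor
  · rintro ⟨h0, l, v, -, -, ⟨c, hc⟩, hh⟩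
    exact ⟨h0, l, E.mkQ v, c, LinearMap.ext hc, hh⟩
  · rintro ⟨h0, l, q, c, hc, hh⟩
    obtain ⟨v, rfl⟩ := E.mkQ_surjective q
    refine ⟨h0, l, v, trivial, fun x hx => ?_, ⟨c, LinearMap.congr_fun hc⟩, hh⟩
    rw [Submodule.mem_bot, Submodule.coe_eq_zero] at hx
    rw [hx, map_zero]

/-- The cone over the variety of minimal rational tangents of the symplectic Grassmannian. -/
def lineCone (ω : LinearMap.BilinForm ℂ V) (k : ℕ) (E : Submodule ℂ V) :
    Set (grTangentSpace k (symplecticGr ω k) E) :=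
  {h | IsLineTangent ω ⊥ ⊤ E h}

/-- `minorForm`, restricted to the tangent space of the symplectic Grassmannian. -/
def tangentMinorForm (ω : LinearMap.BilinForm ℂ V) (k : ℕ) (E : Submodule ℂ V)
    (i : (E × E) × (Module.Dual ℂ (V ⧸ E) × Module.Dual ℂ (V ⧸ E))) :
    grTangentSpace k (symplecticGr ω k) E →ₗ[ℂ] grTangentSpace k (symplecticGr ω k) E →ₗ[ℂ] ℂ :=
  (minorForm i.1.1 i.1.2 i.2.1 i.2.2).domRestrict₁₂ _ _

theorem tangentMinorForm_apply (i : (E × E) × (Module.Dual ℂ (V ⧸ E) × Module.Dual ℂ (V ⧸ E)))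
    (h g : grTangentSpace k (symplecticGr ω k) E) :
    tangentMinorForm ω k E i h g = minorForm i.1.1 i.1.2 i.2.1 i.2.2 h g := rfl

theorem smulRight_mem_grTangentSpace [FiniteDimensional ℂ V] (hω : ∀ x y, ω x y = -ω y x)
    (hE : E ∈ symplecticGr ω k) {l : Module.Dual ℂ E} {q : V ⧸ E} {c : ℂ}
    (hq : quotPairing ω E hE.2 q = c • l) :
    l.smulRight q ∈ grTangentSpace k (symplecticGr ω k) E := by
  by_cases h0 : l.smulRight q = 0
  · rw [h0]
    exact zero_mem _
  · have h1 := (isLineTangent_bot_top_iff hE.2).2 ⟨h0, l, q, c, hq, rfl⟩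
    rw [symplecticGr_eq_between] at hE ⊢
    exact h1.mem_grTangentSpace hω hE

end Cone

/-! ### Arcs, tangent spaces and second fundamental form of the cone of lines. -/

section Cone

variable {V : Type*} [AddCommGroup V] [Module ℂ V] [FiniteDimensional ℂ V] {E : Submodule ℂ V}
  {ω : LinearMap.BilinForm ℂ V} {k : ℕ}

/-- Polarization by rank one tangents: with `z` pairing to `d m`, the maps `(l ± m) ⊗ (q ± r + z)`
are of the required type with constants `c ± d`, and half their difference is the desired sum plus
`m ⊗ z`. -/
theorem smulRight_add_mem_grTangentSpace (hω : ∀ x y, ω x y = -ω y x)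
    (hE : E ∈ symplecticGr ω k) (hsurj : Function.Surjective (quotPairing ω E hE.2))
    {l m : Module.Dual ℂ E} {q r : V ⧸ E} {c d : ℂ} (hq : quotPairing ω E hE.2 q = c • l)
    (hr : quotPairing ω E hE.2 r = c • m + d • l) :
    m.smulRight q + l.smulRight r ∈ grTangentSpace k (symplecticGr ω k) E := by
  obtain ⟨z, hz⟩ := hsurj (d • m)
  have h1 : (l + m).smulRight (q + r + z) ∈ grTangentSpace k (symplecticGr ω k) E :=
    smulRight_mem_grTangentSpace hω hE (c := c + d) (by simp only [map_add, hq, hr, hz]; module)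
  have h2 : (l - m).smulRight (q - r + z) ∈ grTangentSpace k (symplecticGr ω k) E :=
    smulRight_mem_grTangentSpace hω hE (c := c - d)
      (by simp only [map_add, map_sub, hq, hr, hz]; module)
  have h3 := smulRight_mem_grTangentSpace hω hE hz
  have h4 : m.smulRight q + l.smulRight r = (1 / 2 : ℂ) • ((l + m).smulRight (q + r + z) -
      (l - m).smulRight (q - r + z)) - m.smulRight z := by
    ext x
    simp only [LinearMap.add_apply, LinearMap.sub_apply, LinearMap.smul_apply,
      LinearMap.smulRight_apply]
    module
  rw [h4]
  exact sub_mem (Submodule.smul_mem _ _ (sub_mem h1 h2)) h3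

/-- A holomorphic germ with nonzero value is nonzero near the base point. -/
theorem HasHolDeriv.eventually_ne_zero {W : Type*} [AddCommGroup W] [Module ℂ W] {γ : ℂ → W}
    {v : W} (h : HasHolDeriv γ v) (h0 : γ 0 ≠ 0) : ∀ᶠ t in nhds (0 : ℂ), γ t ≠ 0 := by
  obtain ⟨φ, hφ⟩ : ∃ φ : Module.Dual ℂ W, φ (γ 0) ≠ 0 := by
    by_contra! hc
    exact h0 ((Module.forall_dual_apply_eq_zero_iff ℂ _).1 hc)
  filter_upwards [(h.continuousAt φ).eventually_ne hφ] with t ht h0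
  exact ht (by rw [h0, map_zero])

theorem hasHolDeriv_smulRight {l : ℂ → Module.Dual ℂ E} {q : ℂ → V ⧸ E} {l' : Module.Dual ℂ E}
    {q' : V ⧸ E} (hl : HasHolDeriv l l') (hq : HasHolDeriv q q') :
    HasHolDeriv (fun t => (l t).smulRight (q t)) (l'.smulRight (q 0) + (l 0).smulRight q') := by
  have := hq.map₂ (LinearMap.smulRightₗ (R := ℂ) (M := V ⧸ E) (M₂ := E)).flip hl
  rw [add_comm] at this
  exact this

/-- The arcs `(λ + t μ) ⊗ (q + t r + t² z)` in the cone. -/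
theorem exists_arc_lineCone (hω : ∀ x y, ω x y = -ω y x) (hE : E ∈ symplecticGr ω k)
    (hsurj : Function.Surjective (quotPairing ω E hE.2))
    {l m : Module.Dual ℂ E} {q r : V ⧸ E} {c d : ℂ} (hq : quotPairing ω E hE.2 q = c • l)
    (hr : quotPairing ω E hE.2 r = c • m + d • l) {β ξ : grTangentSpace k (symplecticGr ω k) E}
    (hβ : β ≠ 0) (hβq : (β : E →ₗ[ℂ] V ⧸ E) = l.smulRight q)
    (hξ : (ξ : E →ₗ[ℂ] V ⧸ E) = m.smulRight q + l.smulRight r) :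
    ∃ (z : V ⧸ E) (α : ℂ → grTangentSpace k (symplecticGr ω k) E),
      quotPairing ω E hE.2 z = d • m ∧
      (∀ t, (α t : E →ₗ[ℂ] V ⧸ E) = (l + t • m).smulRight (q + t • r + t ^ 2 • z)) ∧
      IsArc (lineCone ω k E) β α ξ := by
  -- The correction `t² z` makes the pairing exactly `(c + t d)(l + t m)` without changing the
  -- velocity.
  obtain ⟨z, hz⟩ := hsurj (d • m)
  have hpair : ∀ t : ℂ, quotPairing ω E hE.2 (q + t • r + t ^ 2 • z) =
      (c + t * d) • (l + t • m) := fun t => by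
    simp only [map_add, map_smul, hq, hr, hz]
    module
  let α : ℂ → grTangentSpace k (symplecticGr ω k) E := fun t =>
    ⟨(l + t • m).smulRight (q + t • r + t ^ 2 • z), smulRight_mem_grTangentSpace hω hE (hpair t)⟩
  have hα : HasHolDeriv α ξ := by
    rw [← hasHolDeriv_coe_iff, hξ]
    simpa using hasHolDeriv_smulRight (hasHolDeriv_affine l m) (hasHolDeriv_quadratic q r z)
  have hα0 : α 0 = β := Subtype.ext (by simp [α, hβq])
  refine ⟨z, α, hz, fun t => rfl, hα0, ?_, hα⟩
  filter_upwards [hα.eventually_ne_zero (hα0 ▸ hβ)] with t ht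
  exact (isLineTangent_bot_top_iff hE.2).2
    ⟨fun h => ht (Subtype.ext h), _, _, _, hpair t, rfl⟩

/-- The solutions of the polarized minor equations at `λ ⊗ q`. -/
theorem exists_eq_add_of_minorForm (hE : E ∈ symplecticGr ω k) {l : Module.Dual ℂ E} {q : V ⧸ E}
    {c : ℂ} (hl : l ≠ 0) (hq0 : q ≠ 0) (hq : quotPairing ω E hE.2 q = c • l)
    {h : E →ₗ[ℂ] V ⧸ E}
    (hs : ∀ x y, quotPairing ω E hE.2 (h x) y = quotPairing ω E hE.2 (h y) x)
    (hm : ∀ x x' y y', minorForm x x' y y' h (l.smulRight q) = 0) :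
    ∃ (m : Module.Dual ℂ E) (r : V ⧸ E) (d : ℂ), h = m.smulRight q + l.smulRight r ∧
      quotPairing ω E hE.2 r = c • m + d • l := by
  obtain ⟨x₀, hx₀⟩ : ∃ x₀, l x₀ = 1 := by
    obtain ⟨x, hx⟩ : ∃ x, l x ≠ 0 := by
      by_contra! hc
      exact hl (LinearMap.ext hc)
    exact ⟨(l x)⁻¹ • x, by simp [hx]⟩
  obtain ⟨y₀, hy₀⟩ : ∃ y : Module.Dual ℂ (V ⧸ E), y q = 1 := by
    obtain ⟨y, hy⟩ : ∃ y : Module.Dual ℂ (V ⧸ E), y q ≠ 0 := by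
      by_contra! hc
      exact hq0 ((Module.forall_dual_apply_eq_zero_iff ℂ _).1 hc)
    exact ⟨(y q)⁻¹ • y, by simp [hy]⟩
  -- This is the polarized minor at `(x, x₀; y, y₀)`, normalized by `l x₀ = y₀ q = 1`.
  have hh : h = (y₀ ∘ₗ h).smulRight q + l.smulRight (h x₀ - y₀ (h x₀) • q) := by
    ext x
    rw [← sub_eq_zero, ← Module.forall_dual_apply_eq_zero_iff ℂ]
    intro y
    have := hm x x₀ y y₀
    simp only [minorForm_apply, LinearMap.smulRight_apply, map_smul, hx₀, hy₀, smul_eq_mul] at this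
    simp only [LinearMap.add_apply, LinearMap.smulRight_apply, LinearMap.comp_apply, map_sub,
      map_add, map_smul, smul_eq_mul]
    linear_combination this
  set m := y₀ ∘ₗ h
  set r := h x₀ - y₀ (h x₀) • q
  -- The constant `d` is forced by evaluating at `x₀`; symmetry of `h` at `(x, x₀)` gives the
  -- identity for all `x`.
  refine ⟨m, r, quotPairing ω E hE.2 r x₀ - c * m x₀, hh, LinearMap.ext fun x => ?_⟩
  have h1 := hs x x₀
  rw [hh] at h1
  simp only [LinearMap.add_apply, LinearMap.smulRight_apply, map_add, map_smul, hq,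
    LinearMap.smul_apply, smul_eq_mul, hx₀] at h1 ⊢
  linear_combination -h1

/-- The minors vanish on the cone, so tangents satisfy their polarizations; conversely each solution
is itself the velocity of an explicit arc. -/
theorem mem_tangentSpace_lineCone_iff (hω : ∀ x y, ω x y = -ω y x) (hE : E ∈ symplecticGr ω k)
    (hsurj : Function.Surjective (quotPairing ω E hE.2))
    {β : grTangentSpace k (symplecticGr ω k) E} (hβ : β ∈ lineCone ω k E)
    (h : grTangentSpace k (symplecticGr ω k) E) :
    h ∈ tangentSpace (lineCone ω k E) β ↔ ∀ i, tangentMinorForm ω k E i h β = 0 := by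
  constructor
  · intro hh i
    refine eq_zero_of_mem_tangentSpace (P := tangentMinorForm ω k E i)
      (fun x y => minorForm_comm _ _ _ _ _ _) ?_ hh
    rintro x ⟨-, l, v, -, -, -, hx⟩
    rw [tangentMinorForm_apply, hx, minorForm_smulRight_smulRight]
    ring
  · intro hh
    obtain ⟨h0, l, q, c, hq, hβq⟩ := (isLineTangent_bot_top_iff hE.2).1 hβ
    obtain ⟨hl, hq0⟩ := ne_zero_of_smulRight_ne_zero (hβq ▸ h0)
    obtain ⟨m, r, d, hm, hr⟩ := exists_eq_add_of_minorForm hE hl hq0 hq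
      (symm_of_mem_grTangentSpace hω hE.2 h.2) fun x x' y y' => by
        rw [← hβq]
        exact hh ((x, x'), (y, y'))
    obtain ⟨z, α, -, -, hα⟩ := exists_arc_lineCone hω hE hsurj hq hr
      (fun hc => h0 (by rw [hc]; rfl)) hβq hm
    exact Submodule.subset_span ⟨α, hα⟩

theorem exists_isMovingVector_lineCone (hω : ∀ x y, ω x y = -ω y x) (hE : E ∈ symplecticGr ω k)
    (hsurj : Function.Surjective (quotPairing ω E hE.2))
    {β ξ ζ : grTangentSpace k (symplecticGr ω k) E} (hβ : β ∈ lineCone ω k E)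
    (hξ : ξ ∈ tangentSpace (lineCone ω k E) β) (hζ : ζ ∈ tangentSpace (lineCone ω k E) β) :
    ∃ v, IsMovingVector (lineCone ω k E) β ξ ζ v := by
  have hT := fun {β} => mem_tangentSpace_lineCone_iff (β := β) hω hE hsurj
  obtain ⟨h0, l, q, c, hq, hβq⟩ := (isLineTangent_bot_top_iff hE.2).1 hβ
  obtain ⟨hl, hq0⟩ := ne_zero_of_smulRight_ne_zero (hβq ▸ h0)
  have hdec : ∀ h : grTangentSpace k (symplecticGr ω k) E,
      h ∈ tangentSpace (lineCone ω k E) β →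
      ∃ (m : Module.Dual ℂ E) (r : V ⧸ E) (d : ℂ), h = m.smulRight q + l.smulRight r ∧
      quotPairing ω E hE.2 r = c • m + d • l := fun h hh =>
    exists_eq_add_of_minorForm hE hl hq0 hq (symm_of_mem_grTangentSpace hω hE.2 h.2)
      fun x x' y y' => by
        rw [← hβq]
        exact (hT hβ h).1 hh ((x, x'), (y, y'))
  obtain ⟨m, r, d, hξm, hr⟩ := hdec ξ hξ
  obtain ⟨n, s, d', hζn, hs⟩ := hdec ζ hζ
  obtain ⟨z, α, hz, hαt, hα⟩ := exists_arc_lineCone hω hE hsurj hq hr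
    (fun hc => h0 (by rw [hc]; rfl)) hβq hξm
  -- Chosen so that `s + t z'` pairs to `(c + t d) n + d' (l + t m)`, the tangency condition along
  -- the arc.
  obtain ⟨z', hz'⟩ := hsurj (d • n + d' • m)
  have hρmem : ∀ t : ℂ, n.smulRight (q + t • r + t ^ 2 • z) + (l + t • m).smulRight (s + t • z') ∈
      grTangentSpace k (symplecticGr ω k) E := fun t =>
    smulRight_add_mem_grTangentSpace hω hE hsurj (c := c + t * d) (d := d')
      (by simp only [map_add, map_smul, hq, hr, hz]; module)
      (by simp only [map_add, map_smul, hs, hz']; module)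
  have hv : n.smulRight r + (m.smulRight s + l.smulRight z') ∈
      grTangentSpace k (symplecticGr ω k) E ∧ HasHolDeriv (fun t : ℂ =>
        n.smulRight (q + t • r + t ^ 2 • z) + (l + t • m).smulRight (s + t • z'))
        (n.smulRight r + (m.smulRight s + l.smulRight z')) := by
    have h1 := (hasHolDeriv_smulRight (hasHolDeriv_const n) (hasHolDeriv_quadratic q r z)).add
      (hasHolDeriv_smulRight (hasHolDeriv_affine l m) (hasHolDeriv_affine s z'))
    have h2 : (0 : Module.Dual ℂ E).smulRight (q + (0 : ℂ) • r + (0 : ℂ) ^ 2 • z) = 0 := by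
      ext; simp
    rw [h2, zero_add, zero_smul, zero_smul, add_zero, add_zero] at h1
    exact ⟨h1.mem (.of_forall hρmem), h1⟩
  refine ⟨⟨_, hv.1⟩, α, fun t => ⟨_, hρmem t⟩, hα, Subtype.ext ?_, ?_, ?_⟩
  · simp [hζn]
  · filter_upwards [hα.2.1] with t ht
    rw [hT ht]
    intro i
    rw [tangentMinorForm_apply, hαt, map_add, LinearMap.add_apply, minorForm_smulRight_smulRight,
      minorForm_smulRight_smulRight]
    ring
  · exact hasHolDeriv_coe_iff.1 hv.2

theorem exists_isSecondFundamentalForm_lineCone (hω : ∀ x y, ω x y = -ω y x)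
    (hE : E ∈ symplecticGr ω k) (hsurj : Function.Surjective (quotPairing ω E hE.2))
    {β : grTangentSpace k (symplecticGr ω k) E} (hβ : β ∈ lineCone ω k E) :
    ∃ σ, IsSecondFundamentalForm (lineCone ω k E) β σ ∧
      ∀ ξ ζ, σ ξ ζ = 0 ↔ ∀ i, tangentMinorForm ω k E i ξ ζ = 0 :=
  exists_isSecondFundamentalForm (P := tangentMinorForm ω k E) (fun _ _ _ => minorForm_comm _ _ _ _ _ _) hβ
    (fun _ hα => mem_tangentSpace_lineCone_iff hω hE hsurj hα)
    fun _ hξ _ hζ => exists_isMovingVector_lineCone hω hE hsurj hβ hξ hζ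

end Cone

/-! ### Nondegeneracy -/

section Nondegeneracy

variable {V : Type*} [AddCommGroup V] [Module ℂ V] [FiniteDimensional ℂ V]
  {F F' E : Submodule ℂ V} {ω : LinearMap.BilinForm ℂ V} {k : ℕ}

theorem tangentSpace_mono {W : Type*} [AddCommGroup W] [Module ℂ W] {S S' : Set W} (h : S ⊆ S')
    (β : W) : tangentSpace S β ≤ tangentSpace S' β :=
  Submodule.span_mono fun _ ⟨α, h0, hα, hd⟩ => ⟨α, h0, hα.mono fun _ ht => h ht, hd⟩

/-- The tangent vectors at `λ ⊗ v` of the arcs `(λ + t μ) ⊗ (v + t v')`. -/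
theorem exists_mem_tangentSpace_isLineTangent (hω : ∀ x y, ω x y = -ω y x)
    (hE : E ∈ symplecticGr ω k) {l m : Module.Dual ℂ E} {v v' : V} {c d : ℂ}
    (hv : v ∈ F') (hv' : v' ∈ F') (hl : ∀ x : E, (x : V) ∈ F → l x = 0)
    (hm : ∀ x : E, (x : V) ∈ F → m x = 0)
    (hc : ∀ (t : ℂ) (x : E), ω (v + t • v') x = (c + t * d) * (l + t • m) x)
    {β : grTangentSpace k (symplecticGr ω k) E} (hβ : β ≠ 0)
    (hβv : (β : E →ₗ[ℂ] V ⧸ E) = l.smulRight (E.mkQ v)) :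
    ∃ ξ : grTangentSpace k (symplecticGr ω k) E,
      (ξ : E →ₗ[ℂ] V ⧸ E) = m.smulRight (E.mkQ v) + l.smulRight (E.mkQ v') ∧
      ξ ∈ tangentSpace {h : grTangentSpace k (symplecticGr ω k) E | IsLineTangent ω F F' E h} β := by
  have hmem : ∀ t : ℂ, (l + t • m).smulRight (E.mkQ v + t • E.mkQ v') ∈
      grTangentSpace k (symplecticGr ω k) E := fun t =>
    smulRight_mem_grTangentSpace hω hE (c := c + t * d) (by
      rw [← map_smul, ← map_add]
      exact LinearMap.ext fun x => hc t x)
  have hd := hasHolDeriv_smulRight (hasHolDeriv_affine l m)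
    (hasHolDeriv_affine (E.mkQ v) (E.mkQ v'))
  rw [zero_smul, zero_smul, add_zero, add_zero] at hd
  let α : ℂ → grTangentSpace k (symplecticGr ω k) E := fun t => ⟨_, hmem t⟩
  let ξ : grTangentSpace k (symplecticGr ω k) E := ⟨_, hd.mem (.of_forall hmem)⟩
  have hα : HasHolDeriv α ξ := hasHolDeriv_coe_iff.1 hd
  have hα0 : α 0 = β := Subtype.ext (by simp [α, hβv])
  refine ⟨ξ, rfl, Submodule.subset_span ⟨α, hα0, ?_, hα⟩⟩
  filter_upwards [hα.eventually_ne_zero (hα0 ▸ hβ)] with t ht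
  refine ⟨fun h => ht (Subtype.ext h), l + t • m, v + t • v', F'.add_mem hv (F'.smul_mem t hv'),
    fun x hx => by simp [hl x hx, hm x hx], ⟨c + t * d, hc t⟩, ?_⟩
  rw [map_add, map_smul]

theorem isNondegeneratePair_of_affineCone_eq {W : Type*} [AddCommGroup W] [Module ℂ W]
    {A B : Set (ℙ ℂ W)} {S S' : Set W} (hA : affineCone A = S) (hB : affineCone B = S')
    (hsub : S' ⊆ S)
    (h : ∀ β ∈ S', ∃ σ, IsSecondFundamentalForm S β σ ∧
      kerAgainst σ (tangentSpace S' β) = (Submodule.span ℂ {β} : Set W)) :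
    IsNondegeneratePair A B := by
  subst hA hB
  refine ⟨fun x hx => ?_, h⟩
  induction x using Projectivization.ind with
  | h w hw => exact (hsub ⟨hw, hx⟩).2

/-- The hypotheses supply the test vectors: `hperp` varies `v` alone, while `hindep` and `hlift`
vary `l` and carry `v` along inside `F'`. -/
theorem isNondegeneratePair_vmrt (hω : ∀ x y, ω x y = -ω y x)
    (hE : E ∈ symplecticGrBetween ω k F F')
    (hsurj : Function.Surjective (quotPairing ω E hE.1.2))
    (hlift : ∀ l : Module.Dual ℂ E, (∀ x : E, (x : V) ∈ F → l x = 0) →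
      ∃ v ∈ F', ∀ x : E, ω v x = l x)
    (hperp : ∃ v ∈ F', v ∉ E ∧ ∀ x : E, ω v x = 0)
    (hindep : ∀ l : Module.Dual ℂ E, ∃ m : Module.Dual ℂ E, (∀ x : E, (x : V) ∈ F → m x = 0) ∧
      ∀ c : ℂ, m ≠ c • l) :
    IsNondegeneratePair (inTangentSpace k (symplecticGr ω k) E (vmrt k (symplecticGr ω k) E))
      (inTangentSpace k (symplecticGr ω k) E (vmrt k (symplecticGrBetween ω k F F') E)) := by
  obtain ⟨v₀, hv₀, hv₀E, hωv₀⟩ := hperp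
  have hex : ∃ h, IsLineTangent ω F F' E h := by
    obtain ⟨m, hm, hm'⟩ := hindep 0
    refine ⟨m.smulRight (E.mkQ v₀), smulRight_ne_zero (fun h => hm' 0 (by rw [h, zero_smul])) ?_, m, v₀, hv₀, hm,
      ⟨0, by simpa using hωv₀⟩, rfl⟩
    exact fun h => hv₀E ((Submodule.Quotient.mk_eq_zero E).1 h)
  have hA : affineCone (inTangentSpace k (symplecticGr ω k) E (vmrt k (symplecticGr ω k) E)) =
      lineCone ω k E := by
    ext h
    have hE' : E ∈ symplecticGrBetween ω k ⊥ ⊤ := by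
      rw [← symplecticGr_eq_between]
      exact hE.1
    have := mem_affineCone_vmrt_iff (X := symplecticGr ω k) hω hE'
      (hex.imp fun _ hh => hh.mono) h
    rwa [← symplecticGr_eq_between] at this
  have hB : affineCone (inTangentSpace k (symplecticGr ω k) E
      (vmrt k (symplecticGrBetween ω k F F') E)) =
        {h : grTangentSpace k (symplecticGr ω k) E | IsLineTangent ω F F' E h} :=
    Set.ext fun h => mem_affineCone_vmrt_iff hω hE hex h
  have hsub : {h : grTangentSpace k (symplecticGr ω k) E | IsLineTangent ω F F' E h} ⊆
      lineCone ω k E := fun h hh => hh.mono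
  refine isNondegeneratePair_of_affineCone_eq hA hB hsub ?_
  intro β hβ
  have hβA := hsub hβ
  have hT := mem_tangentSpace_lineCone_iff hω hE.1 hsurj hβA
  obtain ⟨σ, hσ, hσ0⟩ := exists_isSecondFundamentalForm_lineCone hω hE.1 hsurj hβA
  refine ⟨σ, hσ, Set.ext fun z => ⟨?_, fun hz => ?_⟩⟩
  · rintro ⟨ζ, rfl, hζ⟩
    obtain ⟨h0, l, v, hv, hl, ⟨c, hc⟩, hβv⟩ := hβ
    have hβ0 : β ≠ 0 := fun h => h0 (by rw [h]; rfl)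
    obtain ⟨hl0, hq0⟩ := ne_zero_of_smulRight_ne_zero (hβv ▸ h0)
    obtain ⟨m, r, d, hm, -⟩ := exists_eq_add_of_minorForm (c := c) hE.1 hl0 hq0
      (LinearMap.ext hc) (symm_of_mem_grTangentSpace hω hE.1.2 ζ.1.2) fun x x' y y' => by
        rw [← hβv]
        exact (hT ζ).1 ζ.2 ((x, x'), (y, y'))
    have horth : ∀ ξ : grTangentSpace k (symplecticGr ω k) E,
        ξ ∈ tangentSpace {h : grTangentSpace k (symplecticGr ω k) E |
          IsLineTangent ω F F' E h} β → ∀ x x' y y', minorForm x x' y y' ζ.1.1 ξ.1 = 0 :=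
      fun ξ hξ x x' y y' =>
        (hσ0 ζ ⟨ξ, tangentSpace_mono hsub β hξ⟩).1 (hζ _ hξ) ((x, x'), (y, y'))
    -- variation of `v` alone
    obtain ⟨v', hv', ⟨d', hd'⟩, hvv'⟩ : ∃ v' ∈ F', (∃ d', ∀ x : E, ω v' x = d' * l x) ∧
        ¬ ∃ p : ℂ, E.mkQ v' = p • E.mkQ v := by
      -- If `v₀` is proportional to `v` mod `E`, then `ω(v, ·)` vanishes on `E`, and a lift `v₁` of
      -- `l ≠ 0` cannot be proportional to `v`.
      by_cases hp : ∃ p : ℂ, E.mkQ v₀ = p • E.mkQ v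
      · obtain ⟨p, hp⟩ := hp
        have hp0 : p ≠ 0 := by
          rintro rfl
          rw [zero_smul] at hp
          exact hv₀E ((Submodule.Quotient.mk_eq_zero E).1 hp)
        obtain ⟨v₁, hv₁, hωv₁⟩ := hlift l hl
        refine ⟨v₁, hv₁, ⟨1, by simpa using hωv₁⟩, ?_⟩
        rintro ⟨s, hs⟩
        refine hl0 (LinearMap.ext fun x => ?_)
        have h1 := congr_arg (fun q => quotPairing ω E hE.1.2 q x) hp
        have h2 := congr_arg (fun q => quotPairing ω E hE.1.2 q x) hs
        simp only [map_smul, LinearMap.smul_apply, quotPairing_mkQ, hωv₀, hωv₁,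
          smul_eq_mul] at h1 h2
        have h3 : ω v x = 0 := by simpa [hp0] using h1.symm
        rw [h2, h3, mul_zero, LinearMap.zero_apply]
      · exact ⟨v₀, hv₀, ⟨0, by simpa using hωv₀⟩, hp⟩
    -- Against `l ⊗ v'` only `(m ∧ l)(v ∧ v')` survives, and `v ∧ v' ≠ 0`.
    have hml : ∃ p : ℂ, m = p • l := by
      obtain ⟨ξ, hξ, hξT⟩ := exists_mem_tangentSpace_isLineTangent hω hE.1 (m := 0) (c := c)
        (d := d') hv hv' hl (by simp) (fun t x => by
          simp only [map_add, map_smul, LinearMap.add_apply, LinearMap.smul_apply, hc, hd',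
            LinearMap.zero_apply, smul_eq_mul]
          ring) hβ0 hβv
      have h1 := horth ξ hξT
      rw [hξ, hm] at h1
      simp only [map_add, LinearMap.add_apply, minorForm_smulRight_smulRight] at h1
      obtain ⟨y, y', hy⟩ : ∃ y y' : Module.Dual ℂ (V ⧸ E),
          y (E.mkQ v) * y' (E.mkQ v') - y (E.mkQ v') * y' (E.mkQ v) ≠ 0 := by
        by_contra! hcon
        exact hvv' (exists_eq_smul_of_dual_minors_eq_zero hq0 hcon)
      obtain ⟨x₀, hx₀⟩ : ∃ x, l x ≠ 0 := by
        by_contra! hcon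
        exact hl0 (LinearMap.ext hcon)
      refine ⟨m x₀ / l x₀, LinearMap.ext fun x => ?_⟩
      have h2 := h1 x x₀ y y'
      have h3 : (m x * l x₀ - m x₀ * l x) *
          (y (E.mkQ v) * y' (E.mkQ v') - y (E.mkQ v') * y' (E.mkQ v)) = 0 := by
        simp only [LinearMap.zero_apply] at h2
        linear_combination h2
      have h4 := (mul_eq_zero.1 h3).resolve_right hy
      rw [LinearMap.smul_apply, smul_eq_mul]
      field_simp
      linear_combination h4
    obtain ⟨p, rfl⟩ := hml
    have hζR : ζ.1.1 = l.smulRight (r + p • E.mkQ v) := by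
      rw [hm]
      ext x
      simp only [LinearMap.add_apply, LinearMap.smulRight_apply, LinearMap.smul_apply]
      module
    -- variation of `l` and `v`
    obtain ⟨l', hl', hll'⟩ := hindep l
    obtain ⟨v₁, hv₁, hωv₁⟩ := hlift l' hl'
    -- Moving `v` by `c • v₁` keeps `ω(v + t c v₁, ·) = c (l + t l')` on `E`; the pairing with `ζ`
    -- is then `(l ∧ l')` times the wedge of `ζ`'s second factor with `v`, up to sign.
    obtain ⟨ξ, hξ, hξT⟩ := exists_mem_tangentSpace_isLineTangent hω hE.1 (m := l') (c := c)
        (d := 0) hv (F'.smul_mem c hv₁) hl hl' (fun t x => by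
          simp only [map_add, map_smul, LinearMap.add_apply, LinearMap.smul_apply, hc, hωv₁,
            smul_eq_mul]
          ring) hβ0 hβv
    have h1 := horth ξ hξT
    rw [hξ, hζR] at h1
    simp only [map_add, minorForm_smulRight_smulRight] at h1
    obtain ⟨x, x', hx⟩ : ∃ x x', l x * l' x' - l x' * l' x ≠ 0 := by
      by_contra! hcon
      obtain ⟨x₀, hx₀⟩ : ∃ x, l x ≠ 0 := by
        by_contra! hcon
        exact hl0 (LinearMap.ext hcon)
      refine hll' (l' x₀ / l x₀) (LinearMap.ext fun x => ?_)
      have := hcon x₀ x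
      rw [LinearMap.smul_apply, smul_eq_mul]
      field_simp
      linear_combination this
    obtain ⟨s, hs⟩ := exists_eq_smul_of_dual_minors_eq_zero (r := r + p • E.mkQ v) hq0 fun y y' => by
      have h2 := h1 x x' y y'
      refine (mul_eq_zero.1 (?_ : (l x * l' x' - l x' * l' x) * _ = 0)).resolve_left hx
      simp only [map_add] at h2 ⊢
      linear_combination -h2
    refine Submodule.mem_span_singleton.2 ⟨s, Subtype.ext ?_⟩
    rw [hζR, hs, Submodule.coe_smul, hβv]
    ext x
    simp only [LinearMap.smulRight_apply, LinearMap.smul_apply]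
    rw [smul_comm]
  -- The equations of the tangent space at `β` say precisely that `β` pairs to zero with all of it.
  · obtain ⟨c, rfl⟩ := Submodule.mem_span_singleton.1 hz
    have hββ : β ∈ tangentSpace (lineCone ω k E) β := (hT β).2 fun i => by
      obtain ⟨-, l, v, -, -, -, hβv⟩ := hβ
      rw [tangentMinorForm_apply, hβv, minorForm_smulRight_smulRight]
      ring
    refine ⟨⟨c • β, Submodule.smul_mem _ c hββ⟩, rfl, fun ξ _ => (hσ0 _ _).2 fun i => ?_⟩
    have := (hT ξ).1 ξ.2 i
    rw [tangentMinorForm_apply, minorForm_comm, ← tangentMinorForm_apply] at this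
    rw [map_smul, LinearMap.smul_apply, this, smul_zero]

end Nondegeneracy

/-! ### The general point -/

section GeneralPoint

variable {V : Type*} [AddCommGroup V] [Module ℂ V]

theorem pluckerMinor_eq_zero_of_not_linearIndependent {k : ℕ} (φ : Fin k → Module.Dual ℂ V)
    {w : Fin k → V} (hw : ¬ LinearIndependent ℂ w) : pluckerMinor φ w = 0 := by
  rw [pluckerMinor, ← Matrix.det_transpose]
  exact ((Matrix.detRowAlternating (R := ℂ) (n := Fin k)).compLinearMap
    (LinearMap.pi φ)).map_linearDependent w hw

theorem linearIndependent_iff_exists_pluckerMinor_ne_zero {k : ℕ} {w : Fin k → V} :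
    LinearIndependent ℂ w ↔ ∃ φ : Fin k → Module.Dual ℂ V, pluckerMinor φ w ≠ 0 := by
  constructor
  · intro hw
    obtain ⟨X, hX⟩ := exists_dual_family hw
    exact ⟨X, pluckerMinor_ne_zero_of_dual hX hw rfl⟩
  · rintro ⟨φ, hφ⟩
    by_contra hw
    exact hφ (pluckerMinor_eq_zero_of_not_linearIndependent φ hw)

theorem pluckerMinor_cons_mem_polyFun {k : ℕ} (u : V) (φ : Fin (k + 1) → Module.Dual ℂ V) :
    (fun w : Fin k → V => pluckerMinor φ (Fin.cons u w : Fin (k + 1) → V)) ∈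
      polyFun (Fin k → V) := by
  have hentry : ∀ i j, (fun w : Fin k → V => φ i ((Fin.cons u w : Fin (k + 1) → V) j)) ∈
      polyFun (Fin k → V) := by
    intro i j
    refine Fin.cases ?_ (fun j => ?_) j
    · exact (polyFun (Fin k → V)).algebraMap_mem (φ i u)
    · exact dual_mem_polyFun (φ i ∘ₗ LinearMap.proj (R := ℂ) (φ := fun _ : Fin k => V) j)
  have : (fun w : Fin k → V => pluckerMinor φ (Fin.cons u w : Fin (k + 1) → V)) =
      ∑ τ : Equiv.Perm (Fin (k + 1)), (Equiv.Perm.sign τ : ℤ) •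
        ∏ j, fun w : Fin k → V => φ (τ j) ((Fin.cons u w : Fin (k + 1) → V) j) := by
    ext w
    simp [pluckerMinor, Matrix.det_apply, Units.smul_def]
  rw [this]
  exact sum_mem fun τ _ => zsmul_mem (prod_mem fun j _ => hentry _ _) _

/-- For a frame `w`, membership of `u` in its span is dependence of `(u, w)`, that is, vanishing of
all minors of size `k + 1`. -/
theorem isZariskiClosedGr_setOf_mem (k : ℕ) (u : V) :
    IsZariskiClosedGr k {E : Submodule ℂ V | u ∈ E} := by
  refine ⟨Set.range fun φ : Fin (k + 1) → Module.Dual ℂ V =>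
    fun w : Fin k → V => pluckerMinor φ (Fin.cons u w : Fin (k + 1) → V), ?_, fun w hw => ?_⟩
  · rintro _ ⟨φ, rfl⟩
    exact pluckerMinor_cons_mem_polyFun u φ
  · rw [Set.forall_mem_range, Set.mem_ofPred_eq, ← not_iff_not]
    push Not
    rw [← linearIndependent_iff_exists_pluckerMinor_ne_zero, linearIndependent_finCons]
    exact ⟨fun h => ⟨hw, h⟩, fun h => h.2⟩

theorem continuous_polyFun_comp_affine {W : Type*} [AddCommGroup W] [Module ℂ W] {p : W → ℂ}
    (hp : p ∈ polyFun W) (x x' : W) : Continuous fun t : ℂ => p (x + t • x') := by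
  induction hp using Algebra.adjoin_induction with
  | mem p hp =>
    obtain ⟨φ, rfl⟩ := hp
    simp only [map_add, map_smul, smul_eq_mul]
    fun_prop
  | algebraMap r => exact continuous_const
  | add p q _ _ hp hq => exact hp.add hq
  | mul p q _ _ hp hq => exact hp.mul hq

/-- A closed set containing all but one point of a pencil contains the whole pencil. -/
theorem IsZariskiClosedGr.mem_of_pencil {k : ℕ} {C : Set (Submodule ℂ V)}
    (hC : IsZariskiClosedGr k C) {x x' : Fin k → V} (hx : ∀ t : ℂ, LinearIndependent ℂ (x + t • x'))
    (h : ∀ t : ℂ, t ≠ 0 → Submodule.span ℂ (Set.range (x + t • x')) ∈ C) :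
    Submodule.span ℂ (Set.range x) ∈ C := by
  obtain ⟨P, hP, hPC⟩ := hC
  have h0 : x = x + (0 : ℂ) • x' := by simp
  rw [h0, hPC _ (hx 0)]
  intro p hp
  have hcont := continuous_polyFun_comp_affine (hP hp) x x'
  have hev : (fun t : ℂ => p (x + t • x')) =ᶠ[nhdsWithin 0 {0}ᶜ] fun _ => 0 := by
    filter_upwards [self_mem_nhdsWithin] with t ht
    exact (hPC _ (hx t)).1 (h t ht) p hp
  exact tendsto_nhds_unique ((hcont.tendsto 0).mono_left nhdsWithin_le_nhds)
    (tendsto_const_nhds.congr' hev.symm)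

end GeneralPoint

/-! ### Linear algebra of the symplectic space -/

section Symplectic

variable {V : Type*} [AddCommGroup V] [Module ℂ V] {ℓ : ℕ} {ω : LinearMap.BilinForm ℂ V}
  {e : Module.Basis (Fin (2 * ℓ)) ℂ V}

theorem IsAdaptedBasis.skew (he : IsAdaptedBasis ℓ ω e) (x y : V) : ω x y = -ω y x := by
  suffices ω = -LinearMap.flip ω from LinearMap.congr_fun₂ this x y
  refine LinearMap.ext_basis e e fun i j => ?_
  rw [LinearMap.neg_apply, LinearMap.neg_apply, LinearMap.flip_apply, he i j, he j i]
  split_ifs <;> first | omega | simp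

/-- `ω` pairs `e i` nontrivially with `e i.rev` only, so one pairing reads off one coordinate. -/
theorem IsAdaptedBasis.repr_rev_eq_zero (he : IsAdaptedBasis ℓ ω e) {v : V} {i : Fin (2 * ℓ)}
    (h : ω v (e i) = 0) : e.repr v i.rev = 0 := by
  have h1 : ω v (e i) = ∑ j, e.repr v j * ω (e j) (e i) := by
    conv_lhs => rw [← e.sum_repr v]
    simp only [map_sum, map_smul, LinearMap.sum_apply, LinearMap.smul_apply, smul_eq_mul]
  rw [Finset.sum_eq_single i.rev] at h1
  · rw [h1] at h
    refine (mul_eq_zero.1 h).resolve_right ?_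
    rw [he, if_pos (by rw [Fin.val_rev]; omega)]
    split_ifs <;> simp
  · intro j _ hj
    rw [he, if_neg, mul_zero]
    intro hji
    exact hj (Fin.ext (by rw [Fin.val_rev]; omega))
  · simp

theorem IsAdaptedBasis.surjective (he : IsAdaptedBasis ℓ ω e) (ψ : Module.Dual ℂ V) :
    ∃ v, ω v = ψ := by
  have : FiniteDimensional ℂ V := e.finiteDimensional_of_finite
  have hinj : Function.Injective ω := by
    rw [← LinearMap.ker_eq_bot, LinearMap.ker_eq_bot']
    intro v hv
    refine e.repr.injective (Finsupp.ext fun i => ?_)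
    rw [← Fin.rev_rev i, he.repr_rev_eq_zero (by rw [hv]; rfl), map_zero]
    rfl
  exact (LinearMap.injective_iff_surjective_of_finrank_eq_finrank
    Subspace.dual_finrank_eq.symm).1 hinj ψ

theorem mem_flag_iff {n : ℕ} (e : Module.Basis (Fin n) ℂ V) (j : ℕ) (v : V) :
    v ∈ flag e j ↔ ∀ i : Fin n, j ≤ i → e.repr v i = 0 := by
  have h : {v | ∃ i : Fin n, (i : ℕ) < j ∧ v = e i} = e '' {i | (i : ℕ) < j} := by
    ext v
    simp [eq_comm]
  rw [flag, h, e.mem_span_image]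
  constructor
  · intro h i hi
    by_contra h0
    have h1 : (i : ℕ) < j := h (Finsupp.mem_support_iff.2 h0)
    omega
  · intro h i hi
    by_contra h0
    exact Finsupp.mem_support_iff.1 hi (h i (not_lt.1 h0))

theorem basis_mem_flag {n : ℕ} (e : Module.Basis (Fin n) ℂ V) {j : ℕ} {i : Fin n} (h : (i : ℕ) < j) :
    e i ∈ flag e j :=
  Submodule.subset_span ⟨i, h, rfl⟩

theorem basis_notMem_flag {n : ℕ} (e : Module.Basis (Fin n) ℂ V) (i : Fin n) :
    e i ∉ flag e i := fun h => by
  have := (mem_flag_iff e i (e i)).1 h i le_rfl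
  simp at this

theorem finrank_flag_le {n : ℕ} (e : Module.Basis (Fin n) ℂ V) {j : ℕ} (hj : j ≤ n) :
    Module.finrank ℂ (flag e j) ≤ j := by
  have : FiniteDimensional ℂ V := e.finiteDimensional_of_finite
  have h1 := finrank_range_le_card (R := ℂ) fun i : Fin j => e (Fin.castLE hj i)
  rw [Fintype.card_fin] at h1
  refine le_trans (Submodule.finrank_mono (Submodule.span_mono ?_)) h1
  rintro _ ⟨i, hi, rfl⟩
  exact ⟨⟨i, hi⟩, rfl⟩

/-- With zero-based indices, `i ≤ a` ranges over `a + 1` vectors, so this is `F_{a+1}^⊥ ⊆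
F_{2ℓ-a-1}`: one vector more than `F_a`. -/
theorem IsAdaptedBasis.mem_flag_of_orthogonal (he : IsAdaptedBasis ℓ ω e) {a : ℕ} {v : V}
    (h : ∀ i : Fin (2 * ℓ), (i : ℕ) ≤ a → ω v (e i) = 0) : v ∈ flag e (2 * ℓ - a - 1) := by
  rw [mem_flag_iff]
  intro i hi
  rw [← Fin.rev_rev i]
  exact he.repr_rev_eq_zero (h _ (by rw [Fin.val_rev]; omega))

/-- The orthogonal of `U` has dimension at least `dim V - dim U`, too large to lie in `E`. -/
theorem exists_notMem_orthogonal [FiniteDimensional ℂ V] (ω : LinearMap.BilinForm ℂ V)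
    (E U : Submodule ℂ V)
    (h : Module.finrank ℂ U + Module.finrank ℂ E < Module.finrank ℂ V) :
    ∃ v, v ∉ E ∧ ∀ x ∈ U, ω v x = 0 := by
  by_contra! hcon
  let f : V →ₗ[ℂ] Module.Dual ℂ U := U.dualRestrict ∘ₗ ω
  have hle : LinearMap.ker f ≤ E := fun v hv => by
    by_contra hvE
    obtain ⟨x, hx, hne⟩ := hcon v hvE
    exact hne (LinearMap.congr_fun (LinearMap.mem_ker.1 hv) ⟨x, hx⟩)
  have h1 := LinearMap.finrank_range_add_finrank_ker f
  have h2 : Module.finrank ℂ (LinearMap.range f) ≤ Module.finrank ℂ U :=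
    (Submodule.finrank_le _).trans Subspace.dual_finrank_eq.le
  have h3 := Submodule.finrank_mono hle
  omega

end Symplectic

/-! ### Nondegeneracy off a closed set of the odd symplectic Grassmannian, and density of the
complement. -/

section Symplectic

variable {V : Type*} [AddCommGroup V] [Module ℂ V] {k ℓ a : ℕ} {ω : LinearMap.BilinForm ℂ V}
  {e : Module.Basis (Fin (2 * ℓ)) ℂ V} {E : Submodule ℂ V}

theorem IsAdaptedBasis.mem_flag_of_orthogonal_flag (he : IsAdaptedBasis ℓ ω e) (ha : a < 2 * ℓ)
    {v : V} (h : ∀ x ∈ flag e a, ω v x = 0) (hu : ω v (e ⟨a, ha⟩) = 0) :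
    v ∈ flag e (2 * ℓ - a - 1) := by
  refine he.mem_flag_of_orthogonal fun i hi => ?_
  rcases hi.lt_or_eq with hi | hi
  · exact h _ (basis_mem_flag e hi)
  · rwa [show i = ⟨a, ha⟩ from Fin.ext hi]

theorem IsAdaptedBasis.isNondegeneratePair (hkℓ : k < ℓ) (ha : a + 1 < k)
    (he : IsAdaptedBasis ℓ ω e)
    (hE : E ∈ symplecticGrBetween ω k (flag e a) (flag e (2 * ℓ - a - 1)))
    (hu : e ⟨a, by omega⟩ ∉ E) :
    IsNondegeneratePair (inTangentSpace k (symplecticGr ω k) E (vmrt k (symplecticGr ω k) E))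
      (inTangentSpace k (symplecticGr ω k) E
        (vmrt k (symplecticGrBetween ω k (flag e a) (flag e (2 * ℓ - a - 1))) E)) := by
  have : FiniteDimensional ℂ V := e.finiteDimensional_of_finite
  have hV : Module.finrank ℂ V = 2 * ℓ := by
    rw [Module.finrank_eq_card_basis e, Fintype.card_fin]
  obtain ⟨⟨hfin, hiso⟩, hFE, hEF⟩ := id hE
  set u := e ⟨a, by omega⟩ with hudef
  refine isNondegeneratePair_vmrt he.skew hE (fun l => ?_) (fun l hl => ?_) ?_ fun l => ?_
  · obtain ⟨ψ, rfl⟩ := Subspace.dualRestrict_surjective l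
    obtain ⟨v, rfl⟩ := he.surjective ψ
    exact ⟨E.mkQ v, rfl⟩
  · obtain ⟨ψ, rfl⟩ := Subspace.dualRestrict_surjective l
    obtain ⟨χ, hχ, hχE⟩ := Submodule.exists_le_ker_of_notMem hu
    -- Here `u ∉ E` enters: a multiple of `χ`, zero on `E` but not at `u`, corrects `ψ` to vanish at
    -- `u` without changing it on `E`.
    obtain ⟨v, hv⟩ := he.surjective (ψ - (ψ u / χ u) • χ)
    have hvE : ∀ x : E, ω v x = ψ x := fun x => by
      have : χ x = 0 := hχE x.2
      simp [hv, this]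
    refine ⟨v, he.mem_flag_of_orthogonal_flag (by omega) (fun x hx => ?_) ?_, hvE⟩
    · rw [hvE ⟨x, hFE hx⟩]
      exact hl ⟨x, hFE hx⟩ hx
    · rw [hv]
      simp only [LinearMap.sub_apply, LinearMap.smul_apply, smul_eq_mul]
      rw [div_mul_cancel₀ _ hχ, sub_self]
  · have hU : Module.finrank ℂ (E ⊔ Submodule.span ℂ {u} : Submodule ℂ V) ≤ k + 1 := by
      refine (Submodule.finrank_add_le_finrank_add_finrank _ _).trans ?_
      rw [hfin]
      exact Nat.add_le_add_left ((finrank_span_le_card {u}).trans (by simp)) k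
    -- The count is `(k + 1) + k < 2ℓ`, from `k < ℓ`.
    obtain ⟨v, hvE, hv⟩ := exists_notMem_orthogonal ω E (E ⊔ Submodule.span ℂ {u}) (by omega)
    have hvE' : ∀ x ∈ E, ω v x = 0 := fun x hx => hv x (Submodule.mem_sup_left hx)
    exact ⟨v, he.mem_flag_of_orthogonal_flag (by omega) (fun x hx => hvE' x (hFE hx))
      (hv u (Submodule.mem_sup_right (Submodule.mem_span_singleton_self u))), hvE,
      fun x => hvE' x x.2⟩
  -- `ker l` has dimension at least `k - 1 > a`, so it leaves `F_a`; a functional killing `F_a` but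
  -- not such an `x` is no multiple of `l`.
  · obtain ⟨x, hxl, hxF⟩ : ∃ x : E, l x = 0 ∧ (x : V) ∉ flag e a := by
      by_contra! hcon
      have h1 : (LinearMap.ker l).map E.subtype ≤ flag e a := by
        rintro _ ⟨x, hx, rfl⟩
        exact hcon x hx
      have h2 := Submodule.finrank_mono h1
      rw [Submodule.finrank_map_subtype_eq] at h2
      have h3 := finrank_flag_le e (j := a) (by omega)
      have h4 := LinearMap.finrank_range_add_finrank_ker l
      have h5 := Submodule.finrank_le (LinearMap.range l)
      rw [Module.finrank_self] at h5
      omega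
    obtain ⟨χ, hχ, hχF⟩ := Submodule.exists_le_ker_of_notMem hxF
    refine ⟨χ ∘ₗ E.subtype, fun y hy => hχF hy, fun c hc => hχ ?_⟩
    have := LinearMap.congr_fun hc x
    rw [LinearMap.smul_apply, hxl, smul_zero] at this
    exact this

/-- A point of `Z` containing `e a` is a limit of points which do not contain it. -/
theorem IsAdaptedBasis.mem_of_diff_subset (hkℓ : k < ℓ) (ha : a + 1 < k)
    (he : IsAdaptedBasis ℓ ω e) {C : Set (Submodule ℂ V)} (hC : IsZariskiClosedGr k C)
    (hsub : symplecticGrBetween ω k (flag e a) (flag e (2 * ℓ - a - 1)) \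
      {E | e ⟨a, by omega⟩ ∈ E} ⊆ C) :
    symplecticGrBetween ω k (flag e a) (flag e (2 * ℓ - a - 1)) ⊆ C := by
  intro E hE
  have : FiniteDimensional ℂ V := e.finiteDimensional_of_finite
  have hV : Module.finrank ℂ V = 2 * ℓ := by
    rw [Module.finrank_eq_card_basis e, Fintype.card_fin]
  obtain ⟨⟨hfin, hiso⟩, hFE, hEF⟩ := id hE
  by_cases hu : e ⟨a, by omega⟩ ∈ E
  · obtain ⟨χ, hχ, hχF⟩ := Submodule.exists_le_ker_of_notMem (basis_notMem_flag e ⟨a, by omega⟩)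
    -- Since `e_{a+1}` and `F_a` lie in `E`, orthogonality to `E` puts `v` in `F_{2ℓ-a-1}`: the
    -- pencil of `χ` and `v` stays in `Z`, and `χ(e_{a+1}) ≠ 0` makes it leave the closed set.
    obtain ⟨v, hvE, hv⟩ := exists_notMem_orthogonal ω E E (by omega)
    have hl : χ ∘ₗ E.subtype ≠ 0 := fun h => hχ (LinearMap.congr_fun h ⟨_, hu⟩)
    obtain ⟨f, x, x', ⟨p, hp⟩, hf0, -, hx, hnot⟩ := exists_pencil he.skew hE hl hvE
      (he.mem_flag_of_orthogonal_flag (by omega) (fun x hx => hv x (hFE hx)) (hv _ hu))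
      (fun x hx => hχF hx) (c := 0) (fun x => by rw [hv x x.2, zero_mul])
    have h0 := hC.mem_of_pencil (fun t => (hx t).1) fun t ht => by
      rw [(hx t).2]
      exact hsub ⟨(hp 1 t (Or.inl one_ne_zero)).1, hnot t ht ⟨_, hu⟩ hχ⟩
    have hx0 := (hx 0).2
    rw [zero_smul, add_zero, hf0] at hx0
    rwa [hx0] at h0
  · exact hsub ⟨hE, hu⟩

end Symplectic

end SymplecticVMRT

end

open SymplecticVMRT in
theorem mainTheorem2 {V : Type*} [AddCommGroup V] [Module ℂ V] (k ℓ a : ℕ)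
    (hk : 1 < k) (hkℓ : k < ℓ) (ha : a + 1 < k)
    (ω : LinearMap.BilinForm ℂ V) (e : Module.Basis (Fin (2 * ℓ)) ℂ V)
    (he : IsAdaptedBasis ℓ ω e) (X Z : Set (Submodule ℂ V))
    (hX : X = symplecticGr ω k)
    (hZ : Z = symplecticGrBetween ω k (flag e a) (flag e (2 * ℓ - a - 1))) :
    HoldsAtGeneralPoint k Z fun E =>
      IsNondegeneratePair (inTangentSpace k X E (vmrt k X E))
        (inTangentSpace k X E (vmrt k Z E)) := by
  subst hX hZ
  exact ⟨{E | e ⟨a, by omega⟩ ∈ E}, isZariskiClosedGr_setOf_mem k _,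
    fun C hC hsub => he.mem_of_diff_subset hkℓ ha hC hsub,
    fun E hE hu => he.isNondegeneratePair hkℓ ha hE hu⟩
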